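/- \textbf{Theorem.} Let $T>0$, let $X$ be a Polish topological space, and let $(d_t)_{t\in[0,T]}$ be complete metrics on $X$, each inducing the topology of $X$, such that for some constant $L$ $$|\log(d_t(x,y)/d_s(x,y))|\le L|t-s|\qquad\text{for all } s,t\in[0,T],\ x\neq y \text{ in } X.$$ Let $m$ be a $\sigma$-finite Borel measure on $X$ and let $m_t=e^{-f_t}m$, where $f_t\colon X\to\mathbb R$, $t\in[0,T]$, are Borel functions such that for some constant $L^*$ $$|f_t(x)-f_s(x)|\le L^*|t-s|\qquad\text{for all } s,t\in[0,T],\ x\in X.$$ Then the vector space $H=L^2(X,m_t)$ does not depend on $t$, and its norms $\|\cdot\|_{L^2(X,m_t)}$, $t\in[0,T]$, are equivalent; put $\langle v,w\rangle_t=\int_X vw\,dm_t$. For $u\in H$ let $$\mathrm{Ch}_t(u)=\frac12\inf\Big\{\liminf_{n\to\infty}\int_X(\mathrm{lip}_tu_n)^2\,dm_t \;\Big|\; u_n \text{ Lipschitz},\ \int_X|u_n-u|^2\,dm_t\to0\Big\}\in[0,\infty]$$ be Cheeger's energy of $(X,d_t,m_t)$, where $\mathrm{lip}_tu(x)=\limsup_{y\to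 x}|u(x)-u(y)|/d_t(x,y)$ is the local slope (equal to $0$ at isolated points). The domain $\mathrm{Dom}(\mathrm{Ch})=\{u\in H:\mathrm{Ch}_t(u)<\infty\}$ does not depend on $t$. For $u\in \mathrm{Dom}(\mathrm{Ch})$ let $$D_t^-\mathrm{Ch}_t(u)=\{v\in H:\ \mathrm{Ch}_t(w)-\mathrm{Ch}_t(u)\ge\langle v,w-u\rangle_t\ \text{ for all } w\in H\},$$ and let $D_t^-\mathrm{Ch}_t(u)=\emptyset$ for $u\notin\mathrm{Dom}(\mathrm{Ch})$. For every $\bar u\in\mathrm{Dom}(\mathrm{Ch})$ there is a unique gradient flow of $(\mathrm{Ch}_t)_{t\in[0,T]}$ starting in $\bar u$, that is, a unique absolutely continuous curve $u\colon[0,T]\to H$ which is differentiable in $H$ at almost every $t\in(0,T)$ and satisfies $$\partial_tu_t\in-D_t^-\mathrm{Ch}_t(u_t)\quad\text{for a.e. }t\in(0,T),\qquad \lim_{t\searrow0}u_t=\bar u .$$ Moreover $u_t\in\mathrm{Dom}(\mathrm{Ch})$ for every $t\in[0,T]$. -/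

import Mathlib

open MeasureTheory Set Filter Topology
open scoped ENNReal

namespace DynamicCheeger

noncomputable section

/-- The local slope `lip u (x) = limsup_{y → x, y ≠ x} |u x - u y| / ρ(x, y)` of `u` with respect
to the metric `ρ`, with values in `[0, ∞]`; it is `0` at isolated points. -/
def localSlope {X : Type*} (ρ : MetricSpace X) (u : X → ℝ) (x : X) : ℝ≥0∞ :=
  limsup (fun y => ENNReal.ofReal (|u x - u y| / ρ.dist x y))
    (@nhdsWithin X ρ.toUniformSpace.toTopologicalSpace x {x}ᶜ)

/-- `u` is a Lipschitz function for the metric `ρ`. -/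
def IsLip {X : Type*} (ρ : MetricSpace X) (u : X → ℝ) : Prop :=
  ∃ K : ℝ, ∀ x y, |u x - u y| ≤ K * ρ.dist x y

/-- Cheeger's energy of the metric measure space `(X, ρ, μ)`: half of the infimum of
`liminf ∫ (lip uₙ)² dμ` over all sequences of Lipschitz functions `uₙ` such that
`∫ |uₙ - u|² dμ → 0`. It is `∞` if there is no such sequence. -/
def cheeger {X : Type*} [MeasurableSpace X] (ρ : MetricSpace X) (μ : Measure X) (u : X → ℝ) :
    ℝ≥0∞ :=
  (1 / 2) * ⨅ (w : ℕ → X → ℝ) (_ : ∀ n, IsLip ρ (w n))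
    (_ : Tendsto (fun n => ∫⁻ x, ‖w n x - u x‖ₑ ^ 2 ∂μ) atTop (𝓝 0)),
    liminf (fun n => ∫⁻ x, localSlope ρ (w n) x ^ 2 ∂μ) atTop

/-- The measure `e^{-f} m`. -/
def weighted {X : Type*} [MeasurableSpace X] (m : Measure X) (f : X → ℝ) : Measure X :=
  m.withDensity fun x => ENNReal.ofReal (Real.exp (-f x))

/-- The subdifferential at `u` of Cheeger's energy of `(X, ρ, μ)`, taken with respect to the scalar
product `⟨v, w⟩ = ∫ v w dμ`. The underlying vector space is `L²(X, μ₀)`; below `μ₀` and `μ` are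
measures with mutual densities bounded away from `0` and `∞`, so that `L²(X, μ₀) = L²(X, μ)`
as sets, with equivalent norms. -/
def subdifferential {X : Type*} [MeasurableSpace X] {μ₀ : Measure X} (ρ : MetricSpace X)
    (μ : Measure X) (u : Lp ℝ 2 μ₀) : Set (Lp ℝ 2 μ₀) :=
  {v | cheeger ρ μ u < ⊤ ∧ ∀ w : Lp ℝ 2 μ₀,
    (cheeger ρ μ u : EReal) + ((∫ x, v x * (w x - u x) ∂μ : ℝ) : EReal) ≤ (cheeger ρ μ w : EReal)}

/-- `u : [0, T] → L²` (values outside `[0, T]` are irrelevant) is a gradient flow starting in `u₀`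
for the Cheeger energies of the spaces `(X, d t, μ t)`: it is absolutely continuous on `[0, T]`,
for almost every `t ∈ (0, T)` it has a derivative `∂ₜ u` at `t`, with `-∂ₜ u` in the
subdifferential at `u t`, and `u t → u₀` as `t ↘ 0`. -/
structure IsGradientFlow {X : Type*} [MeasurableSpace X] {μ₀ : Measure X} (d : ℝ → MetricSpace X)
    (μ : ℝ → Measure X) (T : ℝ) (u₀ : Lp ℝ 2 μ₀) (u : ℝ → Lp ℝ 2 μ₀) : Prop where
  absolutelyContinuous : AbsolutelyContinuousOnInterval u 0 T
  deriv_mem : ∀ᵐ t : ℝ, t ∈ Ioo 0 T →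
    ∃ u' : Lp ℝ 2 μ₀, HasDerivAt u u' t ∧ -u' ∈ subdifferential (d t) (μ t) (u t)
  initial : Tendsto u (𝓝[>] 0) (𝓝 u₀)

end

end DynamicCheeger

/-! All the spaces `L²(X, m_t)` are one Hilbert space `H` with scalar products `B t` that are
uniformly equivalent and Lipschitz in `t`. On `H` each `Ch_t` is convex and lower semicontinuous,
and `Ch_t ≤ e^{C|t-s|} Ch_s`. The structure `EvolvingEnergy` records these facts, and nothing else
about Cheeger's energy enters the construction of the flow.

Existence uses implicit Euler steps: given `u`, minimize `E_t(z) + |z-u|_t²/(2h)`. The step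
inequality bounds the energies and `∑ h |velocity|²` independently of `h`. Adding the subgradient
inequalities of two schemes, each tested at the other, gives a derivative bound with error
`O(h₁+h₂)(1+|V₁|²+|V₂|²)`. Grönwall's lemma for the moving scalar product (`form_gronwall`) then
yields `|U₁-U₂|² ≤ Λ(h₁+h₂)`. The schemes are thus Cauchy, and no compactness of sublevels is
needed.

The limit is absolutely continuous because the velocities are bounded in `L²(0,T;H)`, so that a weak
limit of them is its velocity. The inclusion is obtained at each point `τ` of differentiability: the
scalar product is frozen at `τ`, the inequality for `|U-w|_τ²` is integrated over `[τ,s]`, and `h →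
0` is followed by `s ↘ τ` (`subgradient_of_limit`). Uniqueness is the same Grönwall estimate with
error zero (`flow_unique`). -/

namespace DynamicCheeger

/-! ### Evolving convex energies and the implicit Euler step. -/

section Abstract

variable {H : Type*} [NormedAddCommGroup H] [InnerProductSpace ℝ H]

/-- A family of convex, lower semicontinuous energies `E t` together with a family of scalar
products `B t` on `H`, both depending on the time `t` in a log-Lipschitz way. -/
structure EvolvingEnergy (E : ℝ → H → ℝ≥0∞) (B : ℝ → H →L[ℝ] H →L[ℝ] ℝ) (C c K : ℝ) : Prop where
  C_nonneg : 0 ≤ C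
  c_pos : 0 < c
  K_nonneg : 0 ≤ K
  convex : ∀ t u v (a b : ℝ), 0 ≤ a → 0 ≤ b → a + b = 1 →
    E t (a • u + b • v) ≤ ENNReal.ofReal a * E t u + ENNReal.ofReal b * E t v
  lsc : ∀ t, LowerSemicontinuous (E t)
  time : ∀ s t u, E t u ≤ ENNReal.ofReal (Real.exp (C * |t - s|)) * E s u
  symm : ∀ t u v, B t u v = B t v u
  coercive : ∀ t u, c * ‖u‖ ^ 2 ≤ B t u u
  bound : ∀ t u v, |B t u v| ≤ K * ‖u‖ * ‖v‖
  lip : ∀ s t u v, |B t u v - B s u v| ≤ K * |t - s| * ‖u‖ * ‖v‖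

namespace EvolvingEnergy

variable {E : ℝ → H → ℝ≥0∞} {B : ℝ → H →L[ℝ] H →L[ℝ] ℝ} {C c K : ℝ}

lemma ne_top (S : EvolvingEnergy E B C c K) {s : ℝ} {u : H} (h : E s u ≠ ⊤) (t : ℝ) :
    E t u ≠ ⊤ :=
  ne_top_of_le_ne_top (ENNReal.mul_ne_top ENNReal.ofReal_ne_top h) (S.time s t u)

lemma toReal_le (S : EvolvingEnergy E B C c K) {s : ℝ} {u : H} (h : E s u ≠ ⊤) (t : ℝ) :
    (E t u).toReal ≤ Real.exp (C * |t - s|) * (E s u).toReal := by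
  have := ENNReal.toReal_mono (ENNReal.mul_ne_top ENNReal.ofReal_ne_top h) (S.time s t u)
  rwa [ENNReal.toReal_mul, ENNReal.toReal_ofReal (Real.exp_pos _).le] at this

lemma convex_ne_top (S : EvolvingEnergy E B C c K) {t : ℝ} {u v : H} (hu : E t u ≠ ⊤)
    (hv : E t v ≠ ⊤) {a b : ℝ} (ha : 0 ≤ a) (hb : 0 ≤ b) (hab : a + b = 1) :
    E t (a • u + b • v) ≠ ⊤ :=
  ne_top_of_le_ne_top (ENNReal.add_ne_top.2 ⟨ENNReal.mul_ne_top ENNReal.ofReal_ne_top hu,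
    ENNReal.mul_ne_top ENNReal.ofReal_ne_top hv⟩) (S.convex t u v a b ha hb hab)

lemma convex_toReal (S : EvolvingEnergy E B C c K) {t : ℝ} {u v : H} (hu : E t u ≠ ⊤)
    (hv : E t v ≠ ⊤) {a b : ℝ} (ha : 0 ≤ a) (hb : 0 ≤ b) (hab : a + b = 1) :
    (E t (a • u + b • v)).toReal ≤ a * (E t u).toReal + b * (E t v).toReal := by
  have h1 := ENNReal.mul_ne_top (@ENNReal.ofReal_ne_top a) hu
  have h2 := ENNReal.mul_ne_top (@ENNReal.ofReal_ne_top b) hv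
  have := ENNReal.toReal_mono (ENNReal.add_ne_top.2 ⟨h1, h2⟩) (S.convex t u v a b ha hb hab)
  rwa [ENNReal.toReal_add h1 h2, ENNReal.toReal_mul, ENNReal.toReal_mul,
    ENNReal.toReal_ofReal ha, ENNReal.toReal_ofReal hb] at this

lemma energy_le_of_tendsto (S : EvolvingEnergy E B C c K) {t : ℝ} {z : ℕ → H} {w : H}
    (hz : Tendsto z atTop (𝓝 w)) {b : ℝ≥0∞} (hb : ∀ᶠ n in atTop, E t (z n) ≤ b) :
    E t w ≤ b :=
  ((S.lsc t).isClosed_preimage b).mem_of_tendsto hz hb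

/-- The Moreau–Yosida functional whose minimizer is an implicit Euler step. -/
noncomputable def stepFunctional (E : ℝ → H → ℝ≥0∞) (B : ℝ → H →L[ℝ] H →L[ℝ] ℝ) (t h : ℝ)
    (u z : H) : ℝ :=
  (E t z).toReal + B t (z - u) (z - u) / (2 * h)

lemma B_nonneg (S : EvolvingEnergy E B C c K) (t : ℝ) (u : H) : 0 ≤ B t u u :=
  (mul_nonneg S.c_pos.le (sq_nonneg _)).trans (S.coercive t u)

lemma stepFunctional_nonneg (S : EvolvingEnergy E B C c K) {t h : ℝ} (hh : 0 < h) (u z : H) :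
    0 ≤ stepFunctional E B t h u z :=
  add_nonneg ENNReal.toReal_nonneg (div_nonneg (S.B_nonneg _ _) (by positivity))

/-- The gain term comes from the parallelogram identity for `B t`; with coercivity it forces almost
minimizers to be close to each other. -/
lemma stepFunctional_midpoint (S : EvolvingEnergy E B C c K) {t h : ℝ} (hh : 0 < h) {u x y : H}
    (hx : E t x ≠ ⊤) (hy : E t y ≠ ⊤) :
    stepFunctional E B t h u ((1 / 2 : ℝ) • x + (1 / 2 : ℝ) • y) ≤
      (stepFunctional E B t h u x + stepFunctional E B t h u y) / 2 -
        B t (x - y) (x - y) / (8 * h) := by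
  have h1 := S.convex_toReal hx hy (a := 1 / 2) (b := 1 / 2) (by norm_num) (by norm_num)
    (by norm_num)
  have h2 : B t ((1 / 2 : ℝ) • x + (1 / 2 : ℝ) • y - u) ((1 / 2 : ℝ) • x + (1 / 2 : ℝ) • y - u) =
      (B t (x - u) (x - u) + B t (y - u) (y - u)) / 2 - B t (x - y) (x - y) / 4 := by
    simp only [map_sub, map_add, map_smul, _root_.sub_apply,
      _root_.add_apply, _root_.smul_apply, smul_eq_mul,
      S.symm t u x, S.symm t u y, S.symm t y x]
    ring
  unfold stepFunctional
  rw [h2]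
  have h3 : ((B t (x - u) (x - u) + B t (y - u) (y - u)) / 2 - B t (x - y) (x - y) / 4) / (2 * h) =
      (B t (x - u) (x - u) / (2 * h) + B t (y - u) (y - u) / (2 * h)) / 2 -
        B t (x - y) (x - y) / (8 * h) := by
    field_simp
    ring
  rw [h3]
  linarith

/-- Direct method with strong convergence: by `stepFunctional_midpoint` a minimizing sequence is
Cauchy, and lower semicontinuity handles its limit. -/
lemma exists_isMinOn_stepFunctional [CompleteSpace H] (S : EvolvingEnergy E B C c K) {t h : ℝ}
    (hh : 0 < h) {u : H} (hu : E t u ≠ ⊤) :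
    ∃ w, E t w ≠ ⊤ ∧ ∀ z, E t z ≠ ⊤ → stepFunctional E B t h u w ≤ stepFunctional E B t h u z := by
  set Φ := stepFunctional E B t h u with hΦ
  set A := Φ '' {z | E t z ≠ ⊤} with hA
  have hne : A.Nonempty := ⟨_, u, hu, rfl⟩
  have hbdd : BddBelow A := ⟨0, by
    rintro _ ⟨z, -, rfl⟩
    exact S.stepFunctional_nonneg hh u z⟩
  set μ := sInf A with hμ
  have hle : ∀ z, E t z ≠ ⊤ → μ ≤ Φ z := fun z hz => csInf_le hbdd ⟨z, hz, rfl⟩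
  have hex : ∀ n : ℕ, ∃ z, E t z ≠ ⊤ ∧ Φ z < μ + 1 / ((n : ℝ) + 1) := by
    intro n
    obtain ⟨_, ⟨z, hz, rfl⟩, hlt⟩ := exists_lt_of_csInf_lt hne
      (show sInf A < μ + 1 / ((n : ℝ) + 1) from lt_add_of_pos_right _ (by positivity))
    exact ⟨z, hz, hlt⟩
  choose z hz hzlt using hex
  have hc := S.c_pos
  have hdist : ∀ N n m : ℕ, N ≤ n → N ≤ m → ‖z n - z m‖ ^ 2 ≤ 8 * h / c * (1 / ((N : ℝ) + 1)) := by
    intro N n m hn hm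
    have h1 := S.stepFunctional_midpoint hh (u := u) (hz n) (hz m)
    have h2 := hle _ (S.convex_ne_top (hz n) (hz m) (a := 1 / 2) (b := 1 / 2) (by norm_num)
      (by norm_num) (by norm_num))
    have h3 : 1 / ((n : ℝ) + 1) ≤ 1 / ((N : ℝ) + 1) := by gcongr
    have h4 : 1 / ((m : ℝ) + 1) ≤ 1 / ((N : ℝ) + 1) := by gcongr
    have h5 := hzlt n
    have h6 := hzlt m
    have h7 : B t (z n - z m) (z n - z m) / (8 * h) ≤ 1 / ((N : ℝ) + 1) := by
      simp only [hΦ] at h2 h5 h6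
      linarith
    rw [div_le_iff₀ (by positivity)] at h7
    have h8 := S.coercive t (z n - z m)
    rw [div_mul_eq_mul_div, le_div_iff₀ hc]
    linarith
  have hcauchy : CauchySeq z := by
    rw [Metric.cauchySeq_iff]
    intro ε hε
    have hlim : Tendsto (fun N : ℕ => 8 * h / c * (1 / ((N : ℝ) + 1))) atTop (𝓝 0) := by
      simpa using tendsto_one_div_add_atTop_nhds_zero_nat.const_mul (8 * h / c)
    obtain ⟨N, hN⟩ := (hlim.eventually (gt_mem_nhds (show 0 < ε ^ 2 by positivity))).exists
    refine ⟨N, fun n hn m hm => ?_⟩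
    rw [dist_eq_norm]
    exact lt_of_pow_lt_pow_left₀ 2 hε.le ((hdist N n m hn hm).trans_lt hN)
  obtain ⟨w, hw⟩ := cauchySeq_tendsto_of_complete hcauchy
  -- The limit `w` is a minimizer exactly if its energy is at most `e`; the energies along the
  -- sequence have upper bounds tending to `e`.
  set e : ℝ := μ - B t (w - u) (w - u) / (2 * h) with he
  have hlimE : Tendsto (fun n : ℕ => μ + 1 / ((n : ℝ) + 1) - B t (z n - u) (z n - u) / (2 * h)) atTop
      (𝓝 e) := by
    have h1 : Tendsto (fun n => B t (z n - u) (z n - u)) atTop (𝓝 (B t (w - u) (w - u))) := by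
      have h2 : Continuous fun x : H => B t (x - u) (x - u) := by fun_prop
      exact (h2.tendsto w).comp hw
    have h3 := (tendsto_one_div_add_atTop_nhds_zero_nat (𝕜 := ℝ)).const_add μ
    rw [add_zero] at h3
    exact h3.sub (h1.div_const _)
  have hEle : ∀ n, (E t (z n)).toReal ≤
      μ + 1 / ((n : ℝ) + 1) - B t (z n - u) (z n - u) / (2 * h) := fun n => by
    have := (hzlt n).le
    simp only [hΦ, stepFunctional] at this
    linarith
  have hE : ∀ e' > e, E t w ≤ ENNReal.ofReal e' := by
    intro e' he'
    refine S.energy_le_of_tendsto hw ?_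
    filter_upwards [hlimE.eventually (gt_mem_nhds he')] with n hn
    rw [← ENNReal.ofReal_toReal (hz n)]
    exact ENNReal.ofReal_le_ofReal ((hEle n).trans hn.le)
  have he0 : 0 ≤ e := ge_of_tendsto' hlimE fun n => ENNReal.toReal_nonneg.trans (hEle n)
  have hfin : E t w ≠ ⊤ := ne_top_of_le_ne_top ENNReal.ofReal_ne_top (hE (e + 1) (by linarith))
  have hEw : (E t w).toReal ≤ e := by
    refine le_of_forall_gt_imp_ge_of_dense fun e' he' => ?_
    exact ENNReal.toReal_le_of_le_ofReal (he0.trans he'.le) (hE e' he')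
  refine ⟨w, hfin, fun x hx => le_trans ?_ (hle x hx)⟩
  simp only [hΦ, stepFunctional]
  linarith

/-- Euler–Lagrange inequality: the minimizer `w` is compared with `(1-θ)w + θz`, the result divided
by `θ`, and `θ ↘ 0`. -/
lemma exists_euler_step [CompleteSpace H] (S : EvolvingEnergy E B C c K) {t h : ℝ}
    (hh : 0 < h) {u : H} (hu : E t u ≠ ⊤) :
    ∃ w, E t w ≠ ⊤ ∧ ∀ z, E t z ≠ ⊤ →
      B t (h⁻¹ • (w - u)) (w - z) ≤ (E t z).toReal - (E t w).toReal := by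
  obtain ⟨w, hw, hmin⟩ := S.exists_isMinOn_stepFunctional hh hu
  refine ⟨w, hw, fun z hz => ?_⟩
  have key : ∀ θ ∈ Ioo (0 : ℝ) 1, B t (h⁻¹ • (w - u)) (w - z) - θ * (B t (z - w) (z - w) / (2 * h))
      ≤ (E t z).toReal - (E t w).toReal := by
    intro θ ⟨h0, h1⟩
    have hn := S.convex_ne_top hw hz (a := 1 - θ) (b := θ) (by linarith) h0.le (by ring)
    have hcv := S.convex_toReal hw hz (a := 1 - θ) (b := θ) (by linarith) h0.le (by ring)
    have hm := hmin _ hn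
    unfold stepFunctional at hm
    have hB : B t ((1 - θ) • w + θ • z - u) ((1 - θ) • w + θ • z - u) / (2 * h) =
        B t (w - u) (w - u) / (2 * h) - θ * B t (h⁻¹ • (w - u)) (w - z) +
          θ * (θ * (B t (z - w) (z - w) / (2 * h))) := by
      simp only [map_sub, map_add, map_smul, _root_.sub_apply,
        _root_.add_apply, _root_.smul_apply, smul_eq_mul,
        S.symm t u w, S.symm t u z, S.symm t z w]
      field_simp
      ring
    rw [hB] at hm
    have : θ * (B t (h⁻¹ • (w - u)) (w - z) - θ * (B t (z - w) (z - w) / (2 * h))) ≤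
        θ * ((E t z).toReal - (E t w).toReal) := by linarith
    exact le_of_mul_le_mul_left this h0
  have hlim : Tendsto (fun θ : ℝ => B t (h⁻¹ • (w - u)) (w - z) -
      θ * (B t (z - w) (z - w) / (2 * h))) (𝓝[>] 0) (𝓝 (B t (h⁻¹ • (w - u)) (w - z))) := by
    have : Continuous fun θ : ℝ => B t (h⁻¹ • (w - u)) (w - z) -
      θ * (B t (z - w) (z - w) / (2 * h)) := by fun_prop
    simpa using (this.tendsto 0).mono_left nhdsWithin_le_nhds
  refine le_of_tendsto hlim ?_
  filter_upwards [Ioo_mem_nhdsGT (zero_lt_one (α := ℝ))] with θ hθ using key θ hθ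

end EvolvingEnergy

end Abstract

end DynamicCheeger

/-! ### Absolutely continuous curves and Grönwall's lemma for a moving scalar product. -/

namespace DynamicCheeger

/-- The increments of `f` are dominated by those of the identity and of `g`, both absolutely
continuous. Used for primitives, for translates and for `B t (D t) (D t)`. -/
lemma absolutelyContinuousOnInterval_of_dist_le {Y Z : Type*} [PseudoMetricSpace Y]
    [PseudoMetricSpace Z] {f : ℝ → Y} {g : ℝ → Z} {a b P Q : ℝ}
    (hg : AbsolutelyContinuousOnInterval g a b)
    (h : ∀ s ∈ uIcc a b, ∀ t ∈ uIcc a b, dist (f s) (f t) ≤ P * dist s t + Q * dist (g s) (g t)) :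
    AbsolutelyContinuousOnInterval f a b := by
  have hid : AbsolutelyContinuousOnInterval (fun t : ℝ => t) a b :=
    (LipschitzWith.id.lipschitzOnWith (s := uIcc a b)).absolutelyContinuousOnInterval
  unfold AbsolutelyContinuousOnInterval at hg hid ⊢
  have hlim := (hid.const_mul P).add (hg.const_mul Q)
  simp only [mul_zero, add_zero] at hlim
  refine squeeze_zero' (Eventually.of_forall fun _ => Finset.sum_nonneg fun _ _ => dist_nonneg)
    ?_ hlim
  filter_upwards [mem_inf_of_right (mem_principal_self _)] with I hI
  rw [Finset.mul_sum, Finset.mul_sum, ← Finset.sum_add_distrib]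
  exact Finset.sum_le_sum fun i hi => h _ (hI.1 i hi).1 _ (hI.1 i hi).2

lemma absolutelyContinuousOnInterval_integral {F : Type*} [NormedAddCommGroup F] [NormedSpace ℝ F]
    {v : ℝ → F} {a b : ℝ} (hv : IntervalIntegrable v volume a b) (u₀ : F) :
    AbsolutelyContinuousOnInterval (fun t => u₀ + ∫ s in a..t, v s) a b := by
  refine absolutelyContinuousOnInterval_of_dist_le (P := 0) (Q := 1)
    (hv.norm.absolutelyContinuousOnInterval_intervalIntegral (c := a) left_mem_uIcc) ?_
  intro s hs t ht
  have hsub : ∀ r ∈ uIcc a b, uIcc a r ⊆ uIcc a b := fun r hr =>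
    uIcc_subset_uIcc left_mem_uIcc hr
  have hi : ∀ r ∈ uIcc a b, IntervalIntegrable v volume a r := fun r hr =>
    hv.mono_set (hsub r hr)
  rw [dist_eq_norm, dist_eq_norm (∫ r in a..s, ‖v r‖), add_sub_add_left_eq_sub,
    intervalIntegral.integral_interval_sub_left (hi s hs) (hi t ht),
    intervalIntegral.integral_interval_sub_left (hi s hs).norm (hi t ht).norm, zero_mul, zero_add,
    one_mul]
  exact intervalIntegral.norm_integral_le_abs_integral_norm

lemma hasDerivAt_nonneg_of_right {ψ : ℝ → ℝ} {ψ' t : ℝ} (h : HasDerivAt ψ ψ' t) (h0 : ψ t = 0)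
    (hpos : ∀ s, t < s → 0 ≤ ψ s) : 0 ≤ ψ' := by
  have h1 := (hasDerivAt_iff_tendsto_slope.1 h).mono_left
    (nhdsWithin_mono t (fun s (hs : t < s) => ne_of_gt hs) : 𝓝[>] t ≤ 𝓝[≠] t)
  refine ge_of_tendsto h1 ?_
  filter_upwards [self_mem_nhdsWithin] with s hs
  have : t < s := hs
  rw [slope_def_field, h0, sub_zero]
  exact div_nonneg (hpos s this) (by linarith)

section Gronwall

variable {H : Type*} [NormedAddCommGroup H] [InnerProductSpace ℝ H]
  {B : ℝ → H →L[ℝ] H →L[ℝ] ℝ} {K κ : ℝ}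

/-- The form evaluated along an absolutely continuous curve is absolutely continuous. -/
lemma absolutelyContinuousOnInterval_form (hK : 0 ≤ K) (hκ : 0 ≤ κ)
    (bound : ∀ t u v, |B t u v| ≤ K * ‖u‖ * ‖v‖)
    (lip : ∀ s t u, |B t u u - B s u u| ≤ κ * |t - s| * B s u u)
    {D : ℝ → H} {a b : ℝ} (hD : AbsolutelyContinuousOnInterval D a b) :
    AbsolutelyContinuousOnInterval (fun t => B t (D t) (D t)) a b := by
  obtain ⟨R, hR⟩ := hD.exists_bound
  refine absolutelyContinuousOnInterval_of_dist_le (P := κ * (K * R * R)) (Q := 2 * K * R) hD ?_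
  intro s hs t ht
  have h1 := lip t s (D s)
  have h2 : B t (D s) (D s) - B t (D t) (D t) = B t (D s - D t) (D s) + B t (D t) (D s - D t) := by
    simp
  have h3 := bound t (D s - D t) (D s)
  have h4 := bound t (D t) (D s - D t)
  have hs' := hR s hs
  have ht' := hR t ht
  have hR0 : 0 ≤ R := (norm_nonneg _).trans hs'
  have h5 : K * ‖D s - D t‖ * ‖D s‖ ≤ K * ‖D s - D t‖ * R := by gcongr
  have h6 : K * ‖D t‖ * ‖D s - D t‖ ≤ K * R * ‖D s - D t‖ := by gcongr
  have h7 : κ * |s - t| * B t (D s) (D s) ≤ κ * |s - t| * (K * R * R) := by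
    gcongr
    exact ((le_abs_self _).trans (bound t (D s) (D s))).trans (by gcongr)
  rw [Real.dist_eq, Real.dist_eq, dist_eq_norm]
  calc |B s (D s) (D s) - B t (D t) (D t)|
      = |(B s (D s) (D s) - B t (D s) (D s)) + (B t (D s - D t) (D s) +
          B t (D t) (D s - D t))| := by rw [← h2]; ring_nf
    _ ≤ |B s (D s) (D s) - B t (D s) (D s)| + (|B t (D s - D t) (D s)| +
          |B t (D t) (D s - D t)|) := (abs_add_le _ _).trans (by gcongr; exact abs_add_le _ _)
    _ ≤ κ * (K * R * R) * |s - t| + 2 * K * R * ‖D s - D t‖ := by linarith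

/-- A Grönwall estimate for a time-dependent scalar product along an absolutely continuous
curve. -/
lemma form_gronwall (hK : 0 ≤ K) (hκ : 0 ≤ κ) (symm : ∀ t u v, B t u v = B t v u)
    (bound : ∀ t u v, |B t u v| ≤ K * ‖u‖ * ‖v‖)
    (lip : ∀ s t u, |B t u u - B s u u| ≤ κ * |t - s| * B s u u)
    {D : ℝ → H} {a b : ℝ} (hab : a ≤ b) (hD : AbsolutelyContinuousOnInterval D a b)
    {φ : ℝ → ℝ} (hφ : IntervalIntegrable φ volume a b)
    (hD' : ∀ᵐ t : ℝ, t ∈ Ioo a b → ∃ D', HasDerivAt D D' t ∧ B t D' (D t) ≤ φ t) :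
    Real.exp (-κ * b) * B b (D b) (D b) - Real.exp (-κ * a) * B a (D a) (D a) ≤
      ∫ t in a..b, Real.exp (-κ * t) * (2 * φ t) := by
  set g : ℝ → ℝ := fun t => B t (D t) (D t) with hg
  have hgac : AbsolutelyContinuousOnInterval g a b :=
    absolutelyContinuousOnInterval_form hK hκ bound lip hD
  have hexp : ContDiff ℝ 1 fun t : ℝ => Real.exp (-κ * t) := by fun_prop
  have hGac : AbsolutelyContinuousOnInterval (fun t => Real.exp (-κ * t) * g t) a b :=
    hexp.contDiffOn.absolutelyContinuousOnInterval.fun_mul hgac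
  rw [← hGac.integral_deriv_eq_sub]
  refine intervalIntegral.integral_mono_ae_restrict hab hGac.intervalIntegrable_deriv
    ((hφ.const_mul 2).continuousOn_mul (by fun_prop)) ?_
  rw [← Measure.restrict_congr_set Ioo_ae_eq_Icc, EventuallyLE, ae_restrict_iff' measurableSet_Ioo]
  filter_upwards [hgac.ae_differentiableAt, hD'] with t ht1 ht2 ht
  obtain ⟨D', hder, hle⟩ := ht2 ht
  have hgd := (ht1 (by rw [uIcc_of_le hab]; exact Ioo_subset_Icc_self ht)).hasDerivAt
  -- `B` need not be differentiable in time, so there is no product rule for `g`. Instead, for `s >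
  -- t`, `g s` lies below `(1 + κ(s-t)) B t (D s) (D s)`, with equality at `s = t`, which orders the
  -- derivatives at `t`.
  have hB : HasDerivAt (fun s => B t (D s) (D s)) (B t D' (D t) + B t (D t) D') t := by
    have h1 : HasDerivAt (fun s => B t (D s)) (B t D') t := (B t).hasFDerivAt.comp_hasDerivAt t hder
    have := h1.clm_apply hder
    simpa using this
  have hlin : HasDerivAt (fun s : ℝ => 1 + κ * (s - t)) κ t := by
    simpa using (((hasDerivAt_id t).sub_const t).const_mul κ).const_add 1
  have hψ := (hB.mul hlin).sub hgd
  have hpos := hasDerivAt_nonneg_of_right hψ (by simp [hg]) (fun s hs => by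
    have := (le_abs_self _).trans (lip t s (D s))
    rw [abs_of_pos (sub_pos.2 hs)] at this
    simp only [Pi.sub_apply, Pi.mul_apply, hg]
    linarith)
  have hexpd : HasDerivAt (fun t : ℝ => Real.exp (-κ * t)) (Real.exp (-κ * t) * -κ) t := by
    simpa using ((hasDerivAt_id t).const_mul (-κ)).exp
  rw [(hexpd.fun_mul hgd).deriv]
  have : deriv g t - κ * g t ≤ 2 * φ t := by
    rw [symm t (D t) D'] at hpos
    simp only [sub_self, mul_zero, add_zero, mul_one] at hpos
    simp only [hg]
    simp only [hg] at hpos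
    linarith
  calc _ = Real.exp (-κ * t) * (deriv g t - κ * g t) := by ring
    _ ≤ _ := by gcongr

end Gronwall

end DynamicCheeger

/-! ### Step functions on a grid and the implicit Euler scheme. -/

namespace DynamicCheeger

section StepFunction

variable {F : Type*} [NormedAddCommGroup F]

lemma floor_div_eq {h t : ℝ} (hh : 0 < h) {k : ℕ} (ht : t ∈ Ico (k * h) ((k + 1) * h)) :
    ⌊t / h⌋₊ = k := by
  have hk : (0 : ℝ) ≤ k * h := by positivity
  rw [Nat.floor_eq_iff (div_nonneg (hk.trans ht.1) hh.le), le_div_iff₀ hh, div_lt_iff₀ hh]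
  exact ht

/-- The right end of the cell is allowed for `t`; the floor jumps there, on a null set. -/
lemma step_ae_eq {Y : Type*} (G : ℕ → Y) {h t : ℝ} (hh : 0 < h) {k : ℕ} (ht : t ∈ Icc (k * h) ((k + 1) * h)) :
    (fun s => G ⌊s / h⌋₊) =ᵐ[volume.restrict (uIoc (k * h) t)] fun _ => G k := by
  rw [uIoc_of_le ht.1, ← Measure.restrict_congr_set Ioo_ae_eq_Ioc]
  filter_upwards [ae_restrict_mem measurableSet_Ioo] with s hs
  rw [floor_div_eq hh ⟨hs.1.le, hs.2.trans_le ht.2⟩]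

lemma intervalIntegrable_step_cell (G : ℕ → F) {h t : ℝ} (hh : 0 < h) {k : ℕ}
    (ht : t ∈ Icc (k * h) ((k + 1) * h)) :
    IntervalIntegrable (fun s => G ⌊s / h⌋₊) volume (k * h) t :=
  intervalIntegrable_const.congr_ae (step_ae_eq G hh ht).symm

lemma integral_step_cell [NormedSpace ℝ F] [CompleteSpace F] (G : ℕ → F) {h t : ℝ} (hh : 0 < h) {k : ℕ}
    (ht : t ∈ Icc (k * h) ((k + 1) * h)) :
    ∫ s in (k * h)..t, G ⌊s / h⌋₊ = (t - k * h) • G k := by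
  rw [intervalIntegral.integral_congr_ae_restrict (step_ae_eq G hh ht),
    intervalIntegral.integral_const]

lemma intervalIntegrable_step_grid (G : ℕ → F) {h : ℝ} (hh : 0 < h) (n : ℕ) :
    IntervalIntegrable (fun s => G ⌊s / h⌋₊) volume 0 (n * h) := by
  have := IntervalIntegrable.trans_iterate (f := fun s => G ⌊s / h⌋₊) (μ := volume)
    (a := fun k : ℕ => (k : ℝ) * h) (n := n) (fun k _ => by
      have := intervalIntegrable_step_cell G hh (k := k)
        (right_mem_Icc.2 (by nlinarith : (k : ℝ) * h ≤ (k + 1) * h))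
      simpa using this)
  simpa using this

lemma integral_step_grid [NormedSpace ℝ F] [CompleteSpace F] (G : ℕ → F) {h : ℝ} (hh : 0 < h) (n : ℕ) :
    ∫ s in (0 : ℝ)..(n * h), G ⌊s / h⌋₊ = ∑ k ∈ Finset.range n, h • G k := by
  have hcell : ∀ k : ℕ, (k + 1 : ℝ) * h ∈ Icc ((k : ℝ) * h) ((k + 1) * h) := fun k =>
    right_mem_Icc.2 (by nlinarith)
  have := intervalIntegral.sum_integral_adjacent_intervals (f := fun s => G ⌊s / h⌋₊) (μ := volume)
    (a := fun k : ℕ => (k : ℝ) * h) (n := n) (fun k _ => by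
      simpa using intervalIntegrable_step_cell G hh (hcell k))
  simp only [Nat.cast_zero, zero_mul] at this
  rw [← this]
  refine Finset.sum_congr rfl fun k _ => ?_
  push_cast
  rw [integral_step_cell G hh (hcell k)]
  congr 1
  ring

end StepFunction

variable {H : Type*} [NormedAddCommGroup H] [InnerProductSpace ℝ H]

/-- `U` is an approximate gradient flow on `[0, T]` with step size `h`: its velocity `V` is an
element of the subdifferential at the nearby point `W t`, taken at the nearby time `a t`. -/
structure IsApproxFlow (E : ℝ → H → ℝ≥0∞) (B : ℝ → H →L[ℝ] H →L[ℝ] ℝ) (u₀ : H) (T M h : ℝ)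
    (U V W : ℝ → H) (a : ℝ → ℝ) : Prop where
  integrable : IntervalIntegrable V volume 0 T
  integrable_sq : IntervalIntegrable (fun t => ‖V t‖ ^ 2) volume 0 T
  eq_integral : ∀ t, U t = u₀ + ∫ s in (0 : ℝ)..t, V s
  energy : ∫ t in (0 : ℝ)..T, ‖V t‖ ^ 2 ≤ M
  near : ∀ t ∈ Ico 0 T, ‖W t - U t‖ ≤ h * ‖V t‖
  velocity : ∀ t ∈ Ico 0 T, h * ‖V t‖ ^ 2 ≤ M
  time_mem : ∀ t ∈ Ico 0 T, a t ∈ Icc t (t + h)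
  ne_top : ∀ t ∈ Ico 0 T, E (a t) (W t) ≠ ⊤
  energy_le : ∀ t ∈ Ico 0 T, (E (a t) (W t)).toReal ≤ M
  subgradient : ∀ t ∈ Ico 0 T, ∀ z, E (a t) z ≠ ⊤ →
    B (a t) (V t) (W t - z) ≤ (E (a t) z).toReal - (E (a t) (W t)).toReal

namespace EvolvingEnergy

variable {E : ℝ → H → ℝ≥0∞} {B : ℝ → H →L[ℝ] H →L[ℝ] ℝ} {C c K : ℝ}

lemma exists_euler_scheme [CompleteSpace H] (S : EvolvingEnergy E B C c K) {u₀ : H}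
    (hu₀ : E 0 u₀ ≠ ⊤) {h : ℝ} (hh : 0 < h) :
    ∃ w : ℕ → H, w 0 = u₀ ∧ (∀ k : ℕ, E (k * h) (w k) ≠ ⊤) ∧
      ∀ (k : ℕ) (z : H), E ((k + 1) * h) z ≠ ⊤ →
        B ((k + 1) * h) (h⁻¹ • (w (k + 1) - w k)) (w (k + 1) - z) ≤
          (E ((k + 1) * h) z).toReal - (E ((k + 1) * h) (w (k + 1))).toReal := by
  -- Finiteness of the energy does not depend on time, so the recursion can run in the domain at
  -- time `0`.
  have hstep : ∀ (t : ℝ) (u : {u : H // E 0 u ≠ ⊤}), ∃ w : {u : H // E 0 u ≠ ⊤},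
      ∀ z, E t z ≠ ⊤ → B t (h⁻¹ • (w.1 - u.1)) (w.1 - z) ≤ (E t z).toReal - (E t w.1).toReal := by
    intro t u
    obtain ⟨w, hw, hmin⟩ := S.exists_euler_step hh (S.ne_top u.2 t)
    exact ⟨⟨w, S.ne_top hw 0⟩, hmin⟩
  choose R hR using hstep
  let w : ℕ → {u : H // E 0 u ≠ ⊤} := fun n =>
    Nat.rec ⟨u₀, hu₀⟩ (fun k u => R ((k + 1) * h) u) n
  refine ⟨fun n => (w n).1, rfl, fun k => S.ne_top (w k).2 _, fun k z hz => ?_⟩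
  exact hR ((k + 1) * h) (w k) z hz

/-- Testing a step at the preceding point `w n` bounds new energy plus dissipation by the old energy
at the new time, which costs a factor `e^{Ch}`. These factors multiply up to `e^{Cnh}`. -/
lemma euler_energy_estimate (S : EvolvingEnergy E B C c K) {h : ℝ} (hh : 0 < h)
    {w : ℕ → H} (hfin : ∀ k : ℕ, E (k * h) (w k) ≠ ⊤)
    (hw : ∀ (k : ℕ) (z : H), E ((k + 1) * h) z ≠ ⊤ →
        B ((k + 1) * h) (h⁻¹ • (w (k + 1) - w k)) (w (k + 1) - z) ≤
          (E ((k + 1) * h) z).toReal - (E ((k + 1) * h) (w (k + 1))).toReal) (n : ℕ) :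
    (E (n * h) (w n)).toReal +
      ∑ k ∈ Finset.range n, c * (h * ‖h⁻¹ • (w (k + 1) - w k)‖ ^ 2) ≤
      Real.exp (C * (n * h)) * (E 0 (w 0)).toReal := by
  induction n with
  | zero => simp
  | succ n ih =>
    have h1 := hw n (w n) (S.ne_top (hfin n) _)
    have h2 := S.toReal_le (hfin n) ((n + 1) * h)
    have h3 : |((n : ℝ) + 1) * h - n * h| = h := by
      rw [show ((n : ℝ) + 1) * h - n * h = h by ring, abs_of_pos hh]
    rw [h3] at h2
    have h4 : c * (h * ‖h⁻¹ • (w (n + 1) - w n)‖ ^ 2) ≤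
        B ((n + 1) * h) (h⁻¹ • (w (n + 1) - w n)) (w (n + 1) - w n) := by
      have := S.coercive ((n + 1) * h) (h⁻¹ • (w (n + 1) - w n))
      have h5 : B ((n + 1) * h) (h⁻¹ • (w (n + 1) - w n)) (w (n + 1) - w n) =
          h * B ((n + 1) * h) (h⁻¹ • (w (n + 1) - w n)) (h⁻¹ • (w (n + 1) - w n)) := by
        rw [map_smul (B ((n + 1) * h) (h⁻¹ • (w (n + 1) - w n))), smul_eq_mul,
          mul_inv_cancel_left₀ hh.ne']
      rw [h5]
      nlinarith
    rw [Finset.sum_range_succ]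
    push_cast
    have h6 : Real.exp (C * ((n + 1) * h)) = Real.exp (C * h) * Real.exp (C * (n * h)) := by
      rw [← Real.exp_add]; ring_nf
    have h7 : 1 ≤ Real.exp (C * h) := Real.one_le_exp (mul_nonneg S.C_nonneg hh.le)
    have h8 : 0 ≤ ∑ k ∈ Finset.range n, c * (h * ‖h⁻¹ • (w (k + 1) - w k)‖ ^ 2) :=
      Finset.sum_nonneg fun k _ => by have := S.c_pos; positivity
    have h9 := mul_le_mul_of_nonneg_left ih (Real.exp_pos (C * h)).le
    rw [h6, mul_assoc]
    nlinarith

/-- The energy bound for the implicit Euler scheme on `[0, T]`. -/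
noncomputable def energyBound (E : ℝ → H → ℝ≥0∞) (C c T : ℝ) (u₀ : H) : ℝ :=
  Real.exp (C * (T + 1)) * (E 0 u₀).toReal * (1 + c⁻¹)

lemma energyBound_nonneg (S : EvolvingEnergy E B C c K) (T : ℝ) (u₀ : H) :
    0 ≤ energyBound E C c T u₀ := by
  have := S.c_pos
  unfold energyBound
  positivity

/-- On `[0, T)`, `U` is the piecewise affine interpolation of the Euler points and `V` its slope;
`W` is the Euler point at the right end of the current cell and `a` its time. -/
theorem exists_isApproxFlow [CompleteSpace H] (S : EvolvingEnergy E B C c K) {u₀ : H}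
    (hu₀ : E 0 u₀ ≠ ⊤) {T : ℝ} (hT : 0 < T) {h : ℝ} (hh : 0 < h) (h1 : h ≤ 1) :
    ∃ U V W a, IsApproxFlow E B u₀ T (energyBound E C c T u₀) h U V W a := by
  obtain ⟨w, hw0, hfin, hw⟩ := S.exists_euler_scheme hu₀ hh
  set M := energyBound E C c T u₀ with hM
  have hc := S.c_pos
  have hM0 : 0 ≤ M := S.energyBound_nonneg T u₀
  set G : ℕ → H := fun k => h⁻¹ • (w (k + 1) - w k) with hG
  -- The grid covering `[0, T]` overshoots by at most `h ≤ 1`, hence `T + 1`. The factor `1 + c⁻¹`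
  -- in `energyBound` lets one `M` bound both the energies and the velocities.
  have hest : ∀ n : ℕ, (n : ℝ) * h ≤ T + 1 → (E (n * h) (w n)).toReal ≤ M ∧
      ∑ k ∈ Finset.range n, h * ‖G k‖ ^ 2 ≤ M := by
    intro n hn
    have e1 := S.euler_energy_estimate hh hfin hw n
    rw [hw0, ← Finset.mul_sum] at e1
    have e2 : Real.exp (C * (n * h)) ≤ Real.exp (C * (T + 1)) :=
      Real.exp_le_exp.2 (mul_le_mul_of_nonneg_left hn S.C_nonneg)
    have e3 : 0 ≤ (E 0 u₀).toReal := ENNReal.toReal_nonneg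
    have e4 : 0 ≤ ∑ k ∈ Finset.range n, h * ‖G k‖ ^ 2 :=
      Finset.sum_nonneg fun k _ => by positivity
    have e5 : 0 ≤ (E (n * h) (w n)).toReal := ENNReal.toReal_nonneg
    set A := Real.exp (C * (T + 1)) * (E 0 u₀).toReal with hA
    have hA0 : 0 ≤ A := by positivity
    have e6 : Real.exp (C * (n * h)) * (E 0 u₀).toReal ≤ A := by rw [hA]; gcongr
    have e7 : M = A + A * c⁻¹ := by rw [hM, energyBound]; ring
    have e8 : 0 ≤ A * c⁻¹ := by positivity
    have e9 : 0 ≤ c * ∑ k ∈ Finset.range n, h * ‖G k‖ ^ 2 := by positivity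
    refine ⟨by linarith, ?_⟩
    have : ∑ k ∈ Finset.range n, h * ‖G k‖ ^ 2 ≤ A * c⁻¹ := by
      rw [← div_eq_mul_inv, le_div_iff₀ hc]
      linarith
    linarith
  obtain ⟨N, hN1, hN2⟩ : ∃ N : ℕ, T ≤ N * h ∧ (N : ℝ) * h ≤ T + 1 := by
    refine ⟨⌈T / h⌉₊, (div_le_iff₀ hh).1 (Nat.le_ceil _), ?_⟩
    have := Nat.ceil_lt_add_one (div_nonneg hT.le hh.le)
    have := mul_le_mul_of_nonneg_right this.le hh.le
    rw [add_mul, div_mul_cancel₀ _ hh.ne'] at this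
    linarith
  have hcell : ∀ t ∈ Ico 0 T, t ∈ Ico (⌊t / h⌋₊ * h) ((⌊t / h⌋₊ + 1) * h) ∧ ⌊t / h⌋₊ + 1 ≤ N := by
    intro t ht
    have i1 := Nat.floor_le (div_nonneg ht.1 hh.le)
    have i2 := Nat.lt_floor_add_one (t / h)
    rw [le_div_iff₀ hh] at i1
    rw [div_lt_iff₀ hh] at i2
    refine ⟨⟨i1, i2⟩, Nat.succ_le_of_lt ?_⟩
    rw [Nat.floor_lt (div_nonneg ht.1 hh.le), div_lt_iff₀ hh]
    exact ht.2.trans_le hN1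
  have hsub : uIcc 0 T ⊆ uIcc 0 (N * h) := by
    rw [uIcc_of_le hT.le, uIcc_of_le (hT.le.trans hN1)]
    exact Icc_subset_Icc_right hN1
  have hcellN : ∀ t ∈ Ico 0 T, ((⌊t / h⌋₊ + 1 : ℕ) : ℝ) * h ≤ T + 1 := fun t ht =>
    le_trans (by gcongr; exact (hcell t ht).2) hN2
  have hI := intervalIntegrable_step_grid G hh N
  have hI2 := intervalIntegrable_step_grid (fun k => ‖G k‖ ^ 2) hh N
  have hU : ∀ t ∈ Ico 0 T, u₀ + ∫ s in (0 : ℝ)..t, G ⌊s / h⌋₊ =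
      w ⌊t / h⌋₊ + (t - ⌊t / h⌋₊ * h) • G ⌊t / h⌋₊ := by
    intro t ht
    have ht' := Ico_subset_Icc_self (hcell t ht).1
    rw [← intervalIntegral.integral_add_adjacent_intervals
      (intervalIntegrable_step_grid G hh ⌊t / h⌋₊) (intervalIntegrable_step_cell G hh ht'),
      integral_step_grid G hh, integral_step_cell G hh ht', ← add_assoc]
    congr 1
    have : ∀ k, h • G k = w (k + 1) - w k := fun k => by
      simp only [hG]
      rw [smul_inv_smul₀ hh.ne']
    simp only [this]
    rw [Finset.sum_range_sub, hw0]
    abel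
  refine ⟨fun t => u₀ + ∫ s in (0 : ℝ)..t, G ⌊s / h⌋₊, fun t => G ⌊t / h⌋₊,
    fun t => w (⌊t / h⌋₊ + 1), fun t => (⌊t / h⌋₊ + 1) * h, hI.mono_set hsub, hI2.mono_set hsub,
    fun t => rfl, ?_, ?_, ?_, ?_, ?_, ?_, ?_⟩
  · refine (intervalIntegral.integral_mono_interval le_rfl hT.le hN1
      (Eventually.of_forall fun t => by positivity) hI2).trans ?_
    rw [integral_step_grid (fun k => ‖G k‖ ^ 2) hh]
    exact (hest N hN2).2
  · intro t ht
    have ht' := (hcell t ht).1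
    rw [hU t ht]
    have : w (⌊t / h⌋₊ + 1) - (w ⌊t / h⌋₊ + (t - ⌊t / h⌋₊ * h) • G ⌊t / h⌋₊) =
        ((⌊t / h⌋₊ + 1) * h - t) • G ⌊t / h⌋₊ := by
      have : w (⌊t / h⌋₊ + 1) - w ⌊t / h⌋₊ = h • G ⌊t / h⌋₊ := by
        simp only [hG]
        rw [smul_inv_smul₀ hh.ne']
      rw [← sub_sub, this, ← sub_smul]
      congr 1
      ring
    rw [this, norm_smul, Real.norm_eq_abs, abs_of_nonneg (by linarith [ht'.2])]
    gcongr
    nlinarith [ht'.1]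
  · intro t ht
    have := (hest _ (hcellN t ht)).2
    rw [Finset.sum_range_succ] at this
    have h0 : 0 ≤ ∑ k ∈ Finset.range ⌊t / h⌋₊, h * ‖G k‖ ^ 2 :=
      Finset.sum_nonneg fun k _ => by positivity
    linarith
  · intro t ht
    have ht' := (hcell t ht).1
    exact ⟨ht'.2.le, by nlinarith [ht'.1]⟩
  · intro t ht
    exact_mod_cast hfin (⌊t / h⌋₊ + 1)
  · intro t ht
    exact_mod_cast (hest _ (hcellN t ht)).1
  · intro t ht z hz
    exact hw _ z hz

end EvolvingEnergy

end DynamicCheeger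

/-! ### Comparison of two approximate flows. -/

namespace DynamicCheeger

variable {H : Type*} [NormedAddCommGroup H] [InnerProductSpace ℝ H]
  {E : ℝ → H → ℝ≥0∞} {B : ℝ → H →L[ℝ] H →L[ℝ] ℝ} {C c K : ℝ}

namespace EvolvingEnergy

/-- Coercivity makes the Lipschitz bound relative to the form itself, as `form_gronwall` requires.
-/
lemma lip_form (S : EvolvingEnergy E B C c K) (s t : ℝ) (u : H) :
    |B t u u - B s u u| ≤ K / c * |t - s| * B s u u := by
  have h1 := S.lip s t u u
  have h2 := S.coercive s u
  have hc := S.c_pos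
  have hK := S.K_nonneg
  calc _ ≤ K * |t - s| * ‖u‖ * ‖u‖ := h1
    _ = K / c * |t - s| * (c * ‖u‖ ^ 2) := by field_simp
    _ ≤ _ := by gcongr

/-- Grönwall's estimate for curves whose velocities are almost monotone. -/
lemma sq_norm_le_of_deriv_le (S : EvolvingEnergy E B C c K) {D : ℝ → H} {T : ℝ} (hT : 0 ≤ T)
    (hD : AbsolutelyContinuousOnInterval D 0 T) (hD0 : D 0 = 0)
    {φ : ℝ → ℝ} (hφ : IntervalIntegrable φ volume 0 T) (hφ0 : ∀ t, 0 ≤ φ t)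
    (hD' : ∀ᵐ t : ℝ, t ∈ Ioo 0 T → ∃ D', HasDerivAt D D' t ∧ B t D' (D t) ≤ φ t) {t : ℝ}
    (ht : t ∈ Icc 0 T) :
    c * ‖D t‖ ^ 2 ≤ Real.exp (K / c * T) * (2 * ∫ s in (0 : ℝ)..T, φ s) := by
  have hc := S.c_pos
  have hκ : 0 ≤ K / c := div_nonneg S.K_nonneg hc.le
  have hsub : uIcc 0 t ⊆ uIcc 0 T := by
    rw [uIcc_of_le hT, uIcc_of_le ht.1]
    exact Icc_subset_Icc_right ht.2
  have hφt := hφ.mono_set hsub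
  have key := form_gronwall S.K_nonneg hκ S.symm S.bound S.lip_form ht.1 (hD.mono hsub) hφt
    (by filter_upwards [hD'] with s hs hs' using hs ⟨hs'.1, hs'.2.trans_le ht.2⟩)
  rw [hD0, map_zero, mul_zero, sub_zero] at key
  have h1 : ∫ s in (0 : ℝ)..t, Real.exp (-(K / c) * s) * (2 * φ s) ≤
      ∫ s in (0 : ℝ)..t, 2 * φ s := by
    refine intervalIntegral.integral_mono_on ht.1 ((hφt.const_mul 2).continuousOn_mul (by fun_prop))
      (hφt.const_mul 2) fun s hs => ?_
    have : Real.exp (-(K / c) * s) ≤ 1 := Real.exp_le_one_iff.2 (by nlinarith [hs.1])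
    exact mul_le_of_le_one_left (mul_nonneg zero_le_two (hφ0 s)) this
  have h2 : ∫ s in (0 : ℝ)..t, 2 * φ s ≤ 2 * ∫ s in (0 : ℝ)..T, φ s := by
    rw [intervalIntegral.integral_const_mul]
    gcongr
    exact intervalIntegral.integral_mono_interval le_rfl ht.1 ht.2
      (Eventually.of_forall hφ0) hφ
  have h3 := (key.trans h1).trans h2
  have h4 := S.coercive t (D t)
  have h5 : B t (D t) (D t) =
      Real.exp (K / c * t) * (Real.exp (-(K / c) * t) * B t (D t) (D t)) := by
    rw [← mul_assoc, ← Real.exp_add, neg_mul, add_neg_cancel, Real.exp_zero, one_mul]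
  have h6 : 0 ≤ ∫ s in (0 : ℝ)..T, φ s := intervalIntegral.integral_nonneg hT fun s _ => hφ0 s
  calc c * ‖D t‖ ^ 2 ≤ _ := h4
    _ = _ := h5
    _ ≤ Real.exp (K / c * t) * (2 * ∫ s in (0 : ℝ)..T, φ s) := by gcongr
    _ ≤ _ := by
      gcongr
      exact ht.2

end EvolvingEnergy

namespace IsApproxFlow

variable {u₀ : H} {T M h : ℝ} {U V W : ℝ → H} {a : ℝ → ℝ}

lemma absolutelyContinuous (A : IsApproxFlow E B u₀ T M h U V W a) :
    AbsolutelyContinuousOnInterval U 0 T := by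
  rw [show U = _ from funext A.eq_integral]
  exact absolutelyContinuousOnInterval_integral A.integrable u₀

lemma zero (A : IsApproxFlow E B u₀ T M h U V W a) : U 0 = u₀ := by
  rw [A.eq_integral]; simp

lemma ae_hasDerivAt [CompleteSpace H] (A : IsApproxFlow E B u₀ T M h U V W a) :
    ∀ᵐ t : ℝ, t ∈ uIcc 0 T → HasDerivAt U (V t) t := by
  rw [show U = _ from funext A.eq_integral]
  filter_upwards [A.integrable.ae_hasDerivAt_integral] with t ht ht'
  exact (ht ht' 0 left_mem_uIcc).const_add u₀

/-- From `‖V‖ ≤ 1 + ‖V‖²`; what matters is only that the bound is independent of `h`. -/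
lemma norm_sub_le (A : IsApproxFlow E B u₀ T M h U V W a) {t : ℝ} (ht : t ∈ Icc 0 T) :
    ‖U t - u₀‖ ≤ T + M := by
  have hT : 0 ≤ T := ht.1.trans ht.2
  have hsub : uIcc 0 t ⊆ uIcc 0 T := by
    rw [uIcc_of_le hT, uIcc_of_le ht.1]
    exact Icc_subset_Icc_right ht.2
  have hint : IntervalIntegrable (fun s => 1 + ‖V s‖ ^ 2) volume 0 T :=
    intervalIntegrable_const.add A.integrable_sq
  rw [A.eq_integral, add_sub_cancel_left]
  calc ‖∫ s in (0 : ℝ)..t, V s‖ ≤ ∫ s in (0 : ℝ)..t, ‖V s‖ :=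
        intervalIntegral.norm_integral_le_integral_norm ht.1
    _ ≤ ∫ s in (0 : ℝ)..t, (1 + ‖V s‖ ^ 2) :=
        intervalIntegral.integral_mono_on ht.1 (A.integrable.norm.mono_set hsub)
          (hint.mono_set hsub) fun s _ => by nlinarith [sq_nonneg (‖V s‖ - 1)]
    _ ≤ ∫ s in (0 : ℝ)..T, (1 + ‖V s‖ ^ 2) :=
        intervalIntegral.integral_mono_interval le_rfl ht.1 ht.2
          (Eventually.of_forall fun s => by positivity) hint
    _ ≤ T + M := by
        rw [intervalIntegral.integral_add intervalIntegrable_const A.integrable_sq]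
        simpa using A.energy

/-- A velocity may be as large as `h^{-1/2}`, so `near` and `velocity` give a distance of order
`√h`, uniformly in `t`. -/
lemma sq_norm_sub_le (A : IsApproxFlow E B u₀ T M h U V W a) (hh : 0 < h) {t : ℝ}
    (ht : t ∈ Ico 0 T) : ‖W t - U t‖ ^ 2 ≤ h * M := by
  have h1 := A.near t ht
  have h2 := A.velocity t ht
  calc ‖W t - U t‖ ^ 2 ≤ (h * ‖V t‖) ^ 2 := by gcongr
    _ = h * (h * ‖V t‖ ^ 2) := by ring
    _ ≤ _ := by gcongr

lemma norm_le (A : IsApproxFlow E B u₀ T M h U V W a) (hh : 0 < h) (h1 : h ≤ 1) {t : ℝ}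
    (ht : t ∈ Ico 0 T) : ‖W t‖ ≤ ‖u₀‖ + T + 2 * M + 1 := by
  have e1 := A.sq_norm_sub_le hh ht
  have e2 := A.norm_sub_le (Ico_subset_Icc_self ht)
  have hM : 0 ≤ M := (mul_nonneg hh.le (sq_nonneg _)).trans (A.velocity t ht)
  have e3 : h * M ≤ M := mul_le_of_le_one_left hM h1
  have e4 : ‖W t - U t‖ ≤ M + 1 := by nlinarith [sq_nonneg (‖W t - U t‖ - 1)]
  have e5 : ‖W t‖ ≤ ‖W t - U t‖ + ‖U t - u₀‖ + ‖u₀‖ := by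
    calc ‖W t‖ = ‖(W t - U t) + (U t - u₀) + u₀‖ := by congr 1; abel
      _ ≤ _ := norm_add₃_le
  linarith

end IsApproxFlow

namespace EvolvingEnergy

/-- The constant in the comparison of two approximate gradient flows. -/
noncomputable def comparisonConst (C K R M : ℝ) : ℝ :=
  C * Real.exp (2 * C) * M + K * R + K

/-- From `e^x - 1 ≤ x e^x` with `x = Cδ`. The bound `δ ≤ 2` suits `δ = h₁ + h₂` with both steps at
most `1`. -/
lemma toReal_sub_le (S : EvolvingEnergy E B C c K) {s t : ℝ} {u : H} {M δ : ℝ} (h : E s u ≠ ⊤)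
    (hM : (E s u).toReal ≤ M) (hδ : |t - s| ≤ δ) (hδ2 : δ ≤ 2) :
    (E t u).toReal - (E s u).toReal ≤ C * Real.exp (2 * C) * M * δ := by
  have h1 := S.toReal_le h t
  have hC := S.C_nonneg
  have h0 : 0 ≤ (E s u).toReal := ENNReal.toReal_nonneg
  have hδ0 : 0 ≤ δ := (abs_nonneg _).trans hδ
  have h2 : Real.exp (C * |t - s|) ≤ Real.exp (C * δ) := by gcongr
  have h3 : Real.exp (C * δ) - 1 ≤ C * δ * Real.exp (C * δ) := by
    have := Real.add_one_le_exp (-(C * δ))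
    have h4 : Real.exp (-(C * δ)) * Real.exp (C * δ) = 1 := by rw [← Real.exp_add]; simp
    nlinarith [Real.exp_pos (C * δ)]
  have h5 : Real.exp (C * δ) ≤ Real.exp (2 * C) := by
    rw [mul_comm 2]; gcongr
  calc (E t u).toReal - (E s u).toReal
      ≤ (Real.exp (C * δ) - 1) * (E s u).toReal := by nlinarith
    _ ≤ (C * δ * Real.exp (2 * C)) * (E s u).toReal := by
        gcongr
        exact h3.trans (by gcongr)
    _ ≤ (C * δ * Real.exp (2 * C)) * M := by gcongr
    _ = _ := by ring

/-- Bookkeeping for `form_le_of_approx`: `Q = 1 + p² + q²` dominates `1`, `p`, `q` and half of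
`(p+q)²`. -/
lemma comparison_arith {Z K R h₁ h₂ p q : ℝ} (hZ : 0 ≤ Z) (hK : 0 ≤ K) (hR : 0 ≤ R) (h₁0 : 0 ≤ h₁)
    (h₂0 : 0 ≤ h₂) (hp : 0 ≤ p) (hq : 0 ≤ q) :
    2 * (Z * (h₁ + h₂)) + K * h₁ * p * R + K * h₂ * q * R + K * (p + q) * (h₁ * p + h₂ * q) ≤
      4 * (Z + K * R + K) * (h₁ + h₂) * (1 + p ^ 2 + q ^ 2) := by
  set σ := h₁ + h₂ with hσ
  have hσ0 : 0 ≤ σ := by positivity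
  set Q := 1 + p ^ 2 + q ^ 2 with hQ
  have hQ1 : 1 ≤ Q := by nlinarith [sq_nonneg p, sq_nonneg q]
  have hpQ : p ≤ Q := by nlinarith [sq_nonneg (p - 1), sq_nonneg q]
  have hqQ : q ≤ Q := by nlinarith [sq_nonneg (q - 1), sq_nonneg p]
  have i₁ : Z * σ ≤ Z * σ * Q := le_mul_of_one_le_right (by positivity) hQ1
  have i₂ : K * h₁ * p * R ≤ K * σ * Q * R := by gcongr; linarith
  have i₃ : K * h₂ * q * R ≤ K * σ * Q * R := by gcongr; linarith
  have i₄ : K * (p + q) * (h₁ * p + h₂ * q) ≤ K * σ * (2 * Q) := by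
    calc K * (p + q) * (h₁ * p + h₂ * q) ≤ K * (p + q) * (σ * p + σ * q) := by
          gcongr <;> linarith
      _ = K * σ * (p + q) ^ 2 := by ring
      _ ≤ K * σ * (2 * Q) := by
          gcongr
          nlinarith [sq_nonneg (p - q)]
  have i₅ : 0 ≤ K * σ * Q * R := by positivity
  have i₆ : 0 ≤ K * σ * Q := by positivity
  have i₇ : 0 ≤ Z * σ * Q := by positivity
  linarith

/-- Almost monotonicity: each subgradient inequality is tested at the other flow's `W`. In the sum
the energies cancel up to the change of time `|a₂ - a₁| ≤ h₁ + h₂`; freezing the forms at `t` and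
passing from `W` to `U` add errors controlled by the step sizes and the velocities. -/
lemma form_le_of_approx (S : EvolvingEnergy E B C c K) {u₀ : H} {T M h₁ h₂ R : ℝ}
    {U₁ V₁ W₁ U₂ V₂ W₂ : ℝ → H} {a₁ a₂ : ℝ → ℝ}
    (A₁ : IsApproxFlow E B u₀ T M h₁ U₁ V₁ W₁ a₁) (A₂ : IsApproxFlow E B u₀ T M h₂ U₂ V₂ W₂ a₂)
    (h₁0 : 0 < h₁) (h₁1 : h₁ ≤ 1) (h₂0 : 0 < h₂) (h₂1 : h₂ ≤ 1) {t : ℝ} (ht : t ∈ Ico 0 T)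
    (hR : ‖W₁ t - W₂ t‖ ≤ R) :
    B t (V₁ t - V₂ t) (U₁ t - U₂ t) ≤
      4 * comparisonConst C K R M * (h₁ + h₂) * (1 + ‖V₁ t‖ ^ 2 + ‖V₂ t‖ ^ 2) := by
  have hK := S.K_nonneg
  have hC := S.C_nonneg
  have hR0 : 0 ≤ R := (norm_nonneg _).trans hR
  have hM : 0 ≤ M := (mul_nonneg h₁0.le (sq_nonneg _)).trans (A₁.velocity t ht)
  have f₁ := A₁.ne_top t ht
  have f₂ := A₂.ne_top t ht
  have m₁ := A₁.time_mem t ht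
  have m₂ := A₂.time_mem t ht
  have s₁ := A₁.subgradient t ht (W₂ t) (S.ne_top f₂ _)
  have s₂ := A₂.subgradient t ht (W₁ t) (S.ne_top f₁ _)
  have ha : |a₂ t - a₁ t| ≤ h₁ + h₂ := by
    rw [abs_le]; constructor <;> linarith [m₁.1, m₁.2, m₂.1, m₂.2]
  have d₁ := S.toReal_sub_le f₁ (A₁.energy_le t ht) ha (by linarith)
  have d₂ := S.toReal_sub_le f₂ (A₂.energy_le t ht) (abs_sub_comm (a₂ t) _ ▸ ha) (by linarith)
  have l₁ := (abs_le.1 (S.lip t (a₁ t) (V₁ t) (W₁ t - W₂ t))).1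
  have l₂ := (abs_le.1 (S.lip t (a₂ t) (V₂ t) (W₂ t - W₁ t))).1
  have t₁ : |a₁ t - t| ≤ h₁ := by rw [abs_le]; constructor <;> linarith [m₁.1, m₁.2]
  have t₂ : |a₂ t - t| ≤ h₂ := by rw [abs_le]; constructor <;> linarith [m₂.1, m₂.2]
  set p := ‖V₁ t‖ with hp
  set q := ‖V₂ t‖ with hq
  have hp0 : 0 ≤ p := norm_nonneg _
  have hq0 : 0 ≤ q := norm_nonneg _
  have l₁' : K * |a₁ t - t| * p * ‖W₁ t - W₂ t‖ ≤ K * h₁ * p * R := by gcongr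
  have l₂' : K * |a₂ t - t| * q * ‖W₂ t - W₁ t‖ ≤ K * h₂ * q * R := by
    rw [norm_sub_rev]; gcongr
  have b := (le_abs_self _).trans
    (S.bound t (V₁ t - V₂ t) ((U₁ t - W₁ t) - (U₂ t - W₂ t)))
  have n₁ : ‖U₁ t - W₁ t‖ ≤ h₁ * p := norm_sub_rev (U₁ t) _ ▸ A₁.near t ht
  have n₂ : ‖U₂ t - W₂ t‖ ≤ h₂ * q := norm_sub_rev (U₂ t) _ ▸ A₂.near t ht
  have b' : K * ‖V₁ t - V₂ t‖ * ‖(U₁ t - W₁ t) - (U₂ t - W₂ t)‖ ≤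
      K * (p + q) * (h₁ * p + h₂ * q) := by
    have g₁ : ‖V₁ t - V₂ t‖ ≤ p + q := _root_.norm_sub_le _ _
    have g₂ : ‖(U₁ t - W₁ t) - (U₂ t - W₂ t)‖ ≤ h₁ * p + h₂ * q :=
      (_root_.norm_sub_le _ _).trans (add_le_add n₁ n₂)
    gcongr
  have split : B t (V₁ t - V₂ t) (U₁ t - U₂ t) = B t (V₁ t) (W₁ t - W₂ t) +
      B t (V₂ t) (W₂ t - W₁ t) + B t (V₁ t - V₂ t) ((U₁ t - W₁ t) - (U₂ t - W₂ t)) := by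
    simp only [map_sub, _root_.sub_apply]
    ring
  have ar := comparison_arith (Z := C * Real.exp (2 * C) * M) (by positivity) hK hR0 h₁0.le h₂0.le
    hp0 hq0
  rw [split, comparisonConst]
  linarith

end EvolvingEnergy

end DynamicCheeger

/-! ### Cauchy estimate for the schemes and weak limits of velocities. -/

namespace DynamicCheeger

variable {H : Type*} [NormedAddCommGroup H] [InnerProductSpace ℝ H]
  {E : ℝ → H → ℝ≥0∞} {B : ℝ → H →L[ℝ] H →L[ℝ] ℝ} {C c K : ℝ}

namespace EvolvingEnergy

/-- Two approximate gradient flows with step sizes `h₁`, `h₂` have distance `O(√(h₁ + h₂))`. -/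
lemma exists_sq_norm_sub_le [CompleteSpace H] (S : EvolvingEnergy E B C c K) (u₀ : H) {T : ℝ}
    (hT : 0 < T) {M : ℝ} (hM : 0 ≤ M) :
    ∃ Λ, 0 ≤ Λ ∧ ∀ {h₁ h₂ : ℝ} {U₁ V₁ W₁ U₂ V₂ W₂ : ℝ → H} {a₁ a₂ : ℝ → ℝ},
    IsApproxFlow E B u₀ T M h₁ U₁ V₁ W₁ a₁ → IsApproxFlow E B u₀ T M h₂ U₂ V₂ W₂ a₂ →
    0 < h₁ → h₁ ≤ 1 → 0 < h₂ → h₂ ≤ 1 → ∀ t ∈ Icc 0 T,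
    ‖U₁ t - U₂ t‖ ^ 2 ≤ Λ * (h₁ + h₂) := by
  set R := 2 * (‖u₀‖ + T + 2 * M + 1) with hR
  have hK := S.K_nonneg
  have hC := S.C_nonneg
  have hc := S.c_pos
  have hR0 : 0 ≤ R := by positivity
  set N := 4 * comparisonConst C K R M with hN
  have hN0 : 0 ≤ N := by rw [hN, comparisonConst]; positivity
  refine ⟨Real.exp (K / c * T) * (2 * (N * (T + 2 * M))) / c, by positivity, ?_⟩
  intro h₁ h₂ U₁ V₁ W₁ U₂ V₂ W₂ a₁ a₂ A₁ A₂ p₁ q₁ p₂ q₂ t ht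
  have hint : IntervalIntegrable (fun t => 1 + ‖V₁ t‖ ^ 2 + ‖V₂ t‖ ^ 2) volume 0 T :=
    (intervalIntegrable_const.add A₁.integrable_sq).add A₂.integrable_sq
  have key := S.sq_norm_le_of_deriv_le hT.le (A₁.absolutelyContinuous.fun_sub A₂.absolutelyContinuous)
    (by rw [A₁.zero, A₂.zero, sub_self])
    (φ := fun t => N * (h₁ + h₂) * (1 + ‖V₁ t‖ ^ 2 + ‖V₂ t‖ ^ 2))
    (hint.const_mul _) (fun t => by positivity) (by
      filter_upwards [A₁.ae_hasDerivAt, A₂.ae_hasDerivAt] with s d₁ d₂ hs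
      have hs1 : s ∈ uIcc 0 T := by rw [uIcc_of_le hT.le]; exact Ioo_subset_Icc_self hs
      have hs2 : s ∈ Ico 0 T := Ioo_subset_Ico_self hs
      refine ⟨_, (d₁ hs1).fun_sub (d₂ hs1), S.form_le_of_approx A₁ A₂ p₁ q₁ p₂ q₂ hs2 ?_⟩
      refine (_root_.norm_sub_le _ _).trans ?_
      rw [hR]
      linarith [A₁.norm_le p₁ q₁ hs2, A₂.norm_le p₂ q₂ hs2]) ht
  have hI : ∫ s in (0 : ℝ)..T, (1 + ‖V₁ s‖ ^ 2 + ‖V₂ s‖ ^ 2) ≤ T + 2 * M := by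
    rw [intervalIntegral.integral_add (intervalIntegrable_const.add A₁.integrable_sq)
      A₂.integrable_sq, intervalIntegral.integral_add intervalIntegrable_const A₁.integrable_sq]
    have := A₁.energy
    have := A₂.energy
    simp only [intervalIntegral.integral_const, sub_zero, smul_eq_mul, mul_one]
    linarith
  rw [intervalIntegral.integral_const_mul] at key
  rw [div_mul_eq_mul_div, le_div_iff₀ hc, mul_comm _ c]
  refine key.trans ?_
  calc _ ≤ Real.exp (K / c * T) * (2 * (N * (h₁ + h₂) * (T + 2 * M))) := by gcongr
    _ = _ := by ring

end EvolvingEnergy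

/-- If the primitives of an `L²`-bounded sequence converge pointwise, the limit is the primitive of
an integrable function. -/
lemma exists_integral_eq_of_tendsto [CompleteSpace H] {T M : ℝ} (hT : 0 ≤ T) {V : ℕ → ℝ → H}
    (hV : ∀ n, IntervalIntegrable (V n) volume 0 T)
    (hV2 : ∀ n, IntervalIntegrable (fun t => ‖V n t‖ ^ 2) volume 0 T)
    (hM : ∀ n, ∫ t in (0 : ℝ)..T, ‖V n t‖ ^ 2 ≤ M) {u : ℝ → H}
    (hu : ∀ t ∈ Icc 0 T, Tendsto (fun n => ∫ s in (0 : ℝ)..t, V n s) atTop (𝓝 (u t))) :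
    ∃ v : ℝ → H, IntervalIntegrable v volume 0 T ∧
      ∀ t ∈ Icc 0 T, u t = ∫ s in (0 : ℝ)..t, v s := by
  set μ : Measure ℝ := volume.restrict (Ioc 0 T) with hμ
  have : IsFiniteMeasure μ := by rw [hμ]; infer_instance
  have hmem : ∀ n, MemLp (V n) 2 μ := by
    intro n
    have h1 : Integrable (fun t => ‖V n t‖ ^ 2) μ :=
      (intervalIntegrable_iff_integrableOn_Ioc_of_le hT).1 (hV2 n)
    have h2 : AEStronglyMeasurable (V n) μ :=
      ((intervalIntegrable_iff_integrableOn_Ioc_of_le hT).1 (hV n)).1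
    exact (memLp_two_iff_integrable_sq_norm h2).2 h1
  let g : ℕ → Lp H 2 μ := fun n => (hmem n).toLp
  have hg : ∀ n, ‖g n‖ ^ 2 ≤ M := by
    intro n
    refine le_trans (le_of_eq ?_) (hM n)
    rw [← real_inner_self_eq_norm_sq, L2.inner_def, intervalIntegral.integral_of_le hT]
    refine integral_congr_ae ?_
    filter_upwards [(hmem n).coeFn_toLp] with t ht
    rw [ht, real_inner_self_eq_norm_sq]
  -- Banach–Alaoglu in the dual of `L²(0,T;H)`, along an ultrafilter rather than a subsequence; the
  -- radius `M + 1` works because `‖g n‖² ≤ M`.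
  let ℓ : ℕ → WeakDual ℝ (Lp H 2 μ) := fun n =>
    StrongDual.toWeakDual (InnerProductSpace.toDual ℝ (Lp H 2 μ) (g n))
  have hcomp := WeakDual.isCompact_closedBall (𝕜 := ℝ) (0 : StrongDual ℝ (Lp H 2 μ)) (M + 1)
  let F : Ultrafilter ℕ := Ultrafilter.of atTop
  have hF : (F : Filter ℕ) ≤ atTop := Ultrafilter.of_le atTop
  obtain ⟨L, -, hL⟩ := hcomp.ultrafilter_le_nhds' (F.map ℓ) (Ultrafilter.mem_map.2 (univ_mem' fun n => by
    have h1 : ‖g n‖ ≤ M + 1 := by nlinarith [hg n, sq_nonneg (‖g n‖ - 1)]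
    simpa [ℓ] using h1))
  let v : Lp H 2 μ := (InnerProductSpace.toDual ℝ (Lp H 2 μ)).symm (WeakDual.toStrongDual L)
  have hlim : ∀ φ : Lp H 2 μ, Tendsto (fun n => inner ℝ φ (g n)) F (𝓝 (inner ℝ φ v)) := by
    intro φ
    have h1 : Tendsto (fun n => ℓ n φ) F (𝓝 (L φ)) :=
      ((WeakDual.eval_continuous φ).tendsto L).comp hL
    have h2 : L φ = inner ℝ φ v := by
      rw [real_inner_comm, InnerProductSpace.toDual_symm_apply]
      rfl
    have h3 : ∀ n, ℓ n φ = inner ℝ φ (g n) := fun n => by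
      rw [real_inner_comm]
      rfl
    rw [← h2]
    simpa only [h3] using h1
  have hset : ∀ t ∈ Icc 0 T, ∀ f : ℝ → H, ∫ s in Ioc 0 t, f s ∂μ = ∫ s in (0 : ℝ)..t, f s := by
    intro t ht f
    rw [intervalIntegral.integral_of_le ht.1, hμ,
      Measure.restrict_restrict_of_subset (Ioc_subset_Ioc_right ht.2)]
  refine ⟨v, ?_, fun t ht => ?_⟩
  · rw [intervalIntegrable_iff_integrableOn_Ioc_of_le hT]
    exact (Lp.memLp v).integrable one_le_two
  -- Testing the weak limit with `x` times the indicator of `(0, t]` recovers the primitives at `t`.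
  · refine ext_inner_left ℝ fun x => ?_
    have h1 := hlim (indicatorConstLp 2 (measurableSet_Ioc (a := 0) (b := t))
      (measure_ne_top μ _) x)
    simp only [L2.inner_indicatorConstLp_eq_inner_setIntegral] at h1
    have h2 : ∀ n, ∫ s in Ioc 0 t, g n s ∂μ = ∫ s in (0 : ℝ)..t, V n s := fun n => by
      rw [← hset t ht]
      exact integral_congr_ae (ae_restrict_of_ae (hmem n).coeFn_toLp)
    simp only [h2, hset t ht] at h1
    have h3 : Tendsto (fun n => inner ℝ x (∫ s in (0 : ℝ)..t, V n s)) F (𝓝 (inner ℝ x (u t))) :=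
      (((continuous_const.inner continuous_id).tendsto (u t)).comp (hu t ht)).mono_left hF
    exact tendsto_nhds_unique h3 h1

end DynamicCheeger

/-! ### The subdifferential inclusion in the limit. -/

namespace DynamicCheeger

variable {H : Type*} [NormedAddCommGroup H] [InnerProductSpace ℝ H]
  {E : ℝ → H → ℝ≥0∞} {B : ℝ → H →L[ℝ] H →L[ℝ] ℝ} {C c K : ℝ}

namespace EvolvingEnergy

/-- Moves the inequality from time `a r` to the fixed time `τ`. The error linear in `‖V r‖` is split
with a weight `η`: the `‖V r‖²` part integrates to at most a multiple of `η`, and the `η⁻¹` part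
carries the small factor `σ`. -/
lemma frozen_form_le (S : EvolvingEnergy E B C c K) {u₀ : H} {T M h : ℝ} {U V W : ℝ → H}
    {a : ℝ → ℝ} (A : IsApproxFlow E B u₀ T M h U V W a) {r τ σ R η m : ℝ} {w : H}
    (hr : r ∈ Ico 0 T) (hw : E τ w ≠ ⊤) (hσ : |a r - τ| ≤ σ) (hR : ‖W r - w‖ ≤ R) (hη : 0 < η)
    (hm : m ≤ (E τ (W r)).toReal) :
    B τ (V r) (U r - w) ≤ (Real.exp (C * σ) * (E τ w).toReal - Real.exp (-(C * σ)) * m +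
      K * σ * R * η⁻¹) + (K * σ * R * η + K * h) * ‖V r‖ ^ 2 := by
  have hK := S.K_nonneg
  have hC := S.C_nonneg
  have hσ0 : 0 ≤ σ := (abs_nonneg _).trans hσ
  have hR0 : 0 ≤ R := (norm_nonneg _).trans hR
  have hWr := A.ne_top r hr
  have e1 := A.subgradient r hr w (S.ne_top hw _)
  have e2 : (E (a r) w).toReal ≤ Real.exp (C * σ) * (E τ w).toReal :=
    (S.toReal_le hw (a r)).trans (by gcongr)
  have e3 : Real.exp (-(C * σ)) * m ≤ (E (a r) (W r)).toReal := by
    have h1 := S.toReal_le hWr τ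
    rw [abs_sub_comm] at h1
    have h2 : (E τ (W r)).toReal ≤ Real.exp (C * σ) * (E (a r) (W r)).toReal :=
      h1.trans (by gcongr)
    calc Real.exp (-(C * σ)) * m
        ≤ Real.exp (-(C * σ)) * (Real.exp (C * σ) * (E (a r) (W r)).toReal) := by
          gcongr
          exact hm.trans h2
      _ = _ := by rw [← mul_assoc, ← Real.exp_add]; simp
  have e4 := (abs_le.1 (S.lip τ (a r) (V r) (W r - w))).1
  have e5 : K * |a r - τ| * ‖V r‖ * ‖W r - w‖ ≤ K * σ * ‖V r‖ * R := by gcongr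
  have e6 : ‖V r‖ ≤ η * ‖V r‖ ^ 2 + η⁻¹ := by
    have : η * ‖V r‖ ^ 2 + η⁻¹ - ‖V r‖ = η⁻¹ * ((η * ‖V r‖ - 1 / 2) ^ 2 + 3 / 4) := by
      field_simp
      ring
    have h2 : 0 ≤ η⁻¹ * ((η * ‖V r‖ - 1 / 2) ^ 2 + 3 / 4) := by positivity
    linarith
  have e7 : K * σ * ‖V r‖ * R ≤ K * σ * (η * ‖V r‖ ^ 2 + η⁻¹) * R := by gcongr
  have e8 := (le_abs_self _).trans (S.bound τ (V r) (U r - W r))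
  have e9 : K * ‖V r‖ * ‖U r - W r‖ ≤ K * ‖V r‖ * (h * ‖V r‖) := by
    gcongr
    rw [norm_sub_rev]
    exact A.near r hr
  have split : B τ (V r) (U r - w) = B τ (V r) (W r - w) + B τ (V r) (U r - W r) := by
    rw [← map_add]; congr 1; abel
  rw [split]
  linarith

lemma integrated_frozen_form_le [CompleteSpace H] (S : EvolvingEnergy E B C c K) {u₀ : H}
    {T M h : ℝ} {U V W : ℝ → H} {a : ℝ → ℝ} (A : IsApproxFlow E B u₀ T M h U V W a) (hh : 0 < h)
    {τ s R η m : ℝ} {w : H} (hτ : 0 ≤ τ) (hτs : τ ≤ s) (hs : s ≤ T) (hw : E τ w ≠ ⊤)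
    (hR0 : 0 ≤ R) (hη : 0 < η) (hR : ∀ r ∈ Ioo τ s, ‖W r - w‖ ≤ R)
    (hm : ∀ r ∈ Ioo τ s, m ≤ (E τ (W r)).toReal) :
    B τ (U s - w) (U s - w) - B τ (U τ - w) (U τ - w) ≤
      2 * ((Real.exp (C * (s - τ + h)) * (E τ w).toReal - Real.exp (-(C * (s - τ + h))) * m +
        K * (s - τ + h) * R * η⁻¹) * (s - τ) + (K * (s - τ + h) * R * η + K * h) * M) := by
  have hT : 0 ≤ T := hτ.trans (hτs.trans hs)
  have hK := S.K_nonneg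
  have hsub : uIcc τ s ⊆ uIcc 0 T := by
    rw [uIcc_of_le hT, uIcc_of_le hτs]
    exact Icc_subset_Icc hτ hs
  set α := Real.exp (C * (s - τ + h)) * (E τ w).toReal - Real.exp (-(C * (s - τ + h))) * m +
        K * (s - τ + h) * R * η⁻¹ with hα
  set β := K * (s - τ + h) * R * η + K * h with hβ
  have hst : 0 ≤ s - τ := sub_nonneg.2 hτs
  have hβ0 : 0 ≤ β := by positivity
  have hac : AbsolutelyContinuousOnInterval (fun r => U r - w) τ s :=
    absolutelyContinuousOnInterval_of_dist_le (P := 0) (Q := 1)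
      (A.absolutelyContinuous.mono hsub) fun x _ y _ => by simp
  have hint2 := A.integrable_sq.mono_set hsub
  have hint : IntervalIntegrable (fun r => α + β * ‖V r‖ ^ 2) volume τ s :=
    intervalIntegrable_const.add (hint2.const_mul β)
  -- For a constant form and `κ = 0`, Grönwall's lemma is just integration of the derivative of `|U
  -- - w|_τ²`.
  have key := form_gronwall (B := fun _ => B τ) (κ := 0) hK le_rfl (fun _ => S.symm τ)
    (fun _ => S.bound τ) (fun _ _ _ => by simp) hτs hac hint (by
      filter_upwards [A.ae_hasDerivAt] with r hd hr
      refine ⟨V r, (hd (hsub (by rw [uIcc_of_le hτs]; exact Ioo_subset_Icc_self hr))).sub_const w,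
        ?_⟩
      have hr' : r ∈ Ico 0 T := ⟨hτ.trans hr.1.le, hr.2.trans_le hs⟩
      refine S.frozen_form_le A hr' hw ?_ (hR r hr) hη (hm r hr)
      have := A.time_mem r hr'
      rw [abs_le]
      constructor <;> linarith [this.1, this.2, hr.1, hr.2])
  simp only [neg_zero, zero_mul, Real.exp_zero, one_mul] at key
  refine key.trans ?_
  rw [intervalIntegral.integral_const_mul, intervalIntegral.integral_add intervalIntegrable_const
    (hint2.const_mul β), intervalIntegral.integral_const_mul, intervalIntegral.integral_const,
    smul_eq_mul, mul_comm (s - τ)]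
  gcongr
  refine (intervalIntegral.integral_mono_interval hτ hτs hs
    (Eventually.of_forall fun r => by positivity) A.integrable_sq).trans A.energy

/-- The limit of approximate gradient flows satisfies the subdifferential inclusion wherever it is
differentiable. -/
lemma subgradient_of_limit [CompleteSpace H] (S : EvolvingEnergy E B C c K) {u₀ : H} {T M Λ : ℝ}
    (hM : 0 ≤ M) {h : ℕ → ℝ} {U V W : ℕ → ℝ → H} {a : ℕ → ℝ → ℝ}
    (A : ∀ n, IsApproxFlow E B u₀ T M (h n) (U n) (V n) (W n) (a n))
    (h0 : ∀ n, 0 < h n) (h1 : ∀ n, h n ≤ 1) (hlim : Tendsto h atTop (𝓝 0)) {u : ℝ → H}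
    (hu : ∀ n, ∀ t ∈ Icc 0 T, ‖U n t - u t‖ ^ 2 ≤ Λ * h n) {τ : ℝ} (hτ : τ ∈ Ioo 0 T)
    {u' : H} (hu' : HasDerivAt u u' τ) (hfin : E τ (u τ) ≠ ⊤) {w : H} (hw : E τ w ≠ ⊤) :
    B τ u' (u τ - w) ≤ (E τ w).toReal - (E τ (u τ)).toReal := by
  have hK := S.K_nonneg
  have hT : 0 ≤ T := (hτ.1.trans hτ.2).le
  set R := ‖u₀‖ + T + 2 * M + 1 + ‖w‖ with hR
  have hR0 : 0 ≤ R := by positivity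
  have hUlim : ∀ t ∈ Icc 0 T, Tendsto (fun n => U n t) atTop (𝓝 (u t)) := by
    intro t ht
    rw [tendsto_iff_norm_sub_tendsto_zero]
    have h2 : Tendsto (fun n => ‖U n t - u t‖ ^ 2) atTop (𝓝 0) :=
      squeeze_zero (fun n => sq_nonneg _) (fun n => hu n t ht) (by simpa using hlim.const_mul Λ)
    simpa [Real.sqrt_sq (norm_nonneg _)] using h2.sqrt
  refine le_of_forall_pos_le_add fun ε hε => ?_
  -- The velocity error is of order `s - τ` like the main term, so it survives division by `s - τ`
  -- and only `η` makes it small. The other `ε/2` pays for lower semicontinuity.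
  obtain ⟨η, hη, hηε⟩ : ∃ η > 0, K * R * M * η ≤ ε / 2 := by
    refine ⟨ε / 2 / (K * R * M + 1), by positivity, ?_⟩
    rw [← mul_div_assoc, div_le_iff₀ (by positivity)]
    nlinarith [mul_nonneg (mul_nonneg hK hR0) hM]
  -- Lower semicontinuity keeps the energy above `m` near `u τ`, and `W n r` is there for `r` near
  -- `τ` and large `n`; convergence of energies is not needed.
  set m := (E τ (u τ)).toReal - ε / 2 with hm
  obtain ⟨δ, hδ, hball⟩ : ∃ δ > 0, ∀ z, ‖z - u τ‖ < δ → E τ z ≠ ⊤ → m ≤ (E τ z).toReal := by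
    rcases le_or_gt m 0 with hm0 | hm0
    · exact ⟨1, one_pos, fun z _ _ => hm0.trans ENNReal.toReal_nonneg⟩
    · have hlt : ENNReal.ofReal m < E τ (u τ) := by
        rw [ENNReal.ofReal_lt_iff_lt_toReal hm0.le hfin]
        linarith
      obtain ⟨δ, hδ, hb⟩ := Metric.eventually_nhds_iff.1 (S.lsc τ (u τ) _ hlt)
      refine ⟨δ, hδ, fun z hz hzf => ?_⟩
      exact ((ENNReal.ofReal_lt_iff_lt_toReal hm0.le hzf).1 (hb (by rwa [dist_eq_norm]))).le
  obtain ⟨ρ, hρ, hcont⟩ : ∃ ρ > 0, ∀ r, |r - τ| < ρ → ‖u r - u τ‖ < δ / 3 := by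
    obtain ⟨ρ, hρ, hb⟩ := Metric.continuousAt_iff.1 hu'.continuousAt (δ / 3) (by positivity)
    exact ⟨ρ, hρ, fun r hr => by simpa [dist_eq_norm] using hb (by simpa [Real.dist_eq] using hr)⟩
  have hsmall : ∀ᶠ n in atTop, Λ * h n < (δ / 3) ^ 2 ∧ h n * M < (δ / 3) ^ 2 := by
    have hp : (0 : ℝ) < (δ / 3) ^ 2 := by positivity
    have l1 : Tendsto (fun n => Λ * h n) atTop (𝓝 0) := by simpa using hlim.const_mul Λ
    have l2 : Tendsto (fun n => h n * M) atTop (𝓝 0) := by simpa using hlim.mul_const M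
    exact (l1.eventually (gt_mem_nhds hp)).and (l2.eventually (gt_mem_nhds hp))
  -- the integrated inequality in the limit `n → ∞`
  have hint : ∀ s, τ < s → s < T → s - τ < ρ →
      B τ (u s - w) (u s - w) - B τ (u τ - w) (u τ - w) ≤
        2 * ((Real.exp (C * (s - τ)) * (E τ w).toReal - Real.exp (-(C * (s - τ))) * m +
          K * (s - τ) * R * η⁻¹) * (s - τ) + K * (s - τ) * R * η * M) := by
    intro s hτs hsT hsρ
    have hcB : Continuous fun x : H => B τ (x - w) (x - w) := by fun_prop
    have l1 : Tendsto (fun n => B τ (U n s - w) (U n s - w) - B τ (U n τ - w) (U n τ - w)) atTop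
        (𝓝 (B τ (u s - w) (u s - w) - B τ (u τ - w) (u τ - w))) :=
      ((hcB.tendsto _).comp (hUlim s ⟨(hτ.1.trans hτs).le, hsT.le⟩)).sub
        ((hcB.tendsto _).comp (hUlim τ ⟨hτ.1.le, hτ.2.le⟩))
    have hcR : Continuous fun x : ℝ => 2 * ((Real.exp (C * (s - τ + x)) * (E τ w).toReal -
        Real.exp (-(C * (s - τ + x))) * m + K * (s - τ + x) * R * η⁻¹) * (s - τ) +
          (K * (s - τ + x) * R * η + K * x) * M) := by fun_prop
    have l2 := (hcR.tendsto 0).comp hlim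
    simp only [add_zero, mul_zero] at l2
    refine le_of_tendsto_of_tendsto l1 l2 ?_
    filter_upwards [hsmall] with n hn
    refine S.integrated_frozen_form_le (A n) (h0 n) hτ.1.le hτs.le hsT.le hw hR0 hη ?_ ?_
    · intro r hr
      have := (A n).norm_le (h0 n) (h1 n) ⟨hτ.1.le.trans hr.1.le, hr.2.trans hsT⟩
      refine (_root_.norm_sub_le _ _).trans ?_
      rw [hR]
      linarith
    · intro r hr
      have hr' : r ∈ Ico 0 T := ⟨hτ.1.le.trans hr.1.le, hr.2.trans hsT⟩
      refine hball _ ?_ (S.ne_top ((A n).ne_top r hr') τ)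
      have d1 : ‖W n r - U n r‖ < δ / 3 := lt_of_pow_lt_pow_left₀ 2 (by positivity)
        (((A n).sq_norm_sub_le (h0 n) hr').trans_lt hn.2)
      have d2 : ‖U n r - u r‖ < δ / 3 := lt_of_pow_lt_pow_left₀ 2 (by positivity)
        ((hu n r (Ico_subset_Icc_self hr')).trans_lt hn.1)
      have d3 : ‖u r - u τ‖ < δ / 3 := hcont r (by
        rw [abs_of_pos (sub_pos.2 hr.1)]
        linarith [hr.2])
      calc ‖W n r - u τ‖ = ‖(W n r - U n r) + (U n r - u r) + (u r - u τ)‖ := by congr 1; abel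
        _ ≤ ‖W n r - U n r‖ + ‖U n r - u r‖ + ‖u r - u τ‖ := norm_add₃_le
        _ < δ := by linarith
  have hder : HasDerivAt (fun s => B τ (u s - w) (u s - w)) (2 * B τ u' (u τ - w)) τ := by
    have e1 := hu'.sub_const w
    have e2 : HasDerivAt (fun s => B τ (u s - w)) (B τ u') τ :=
      (B τ).hasFDerivAt.comp_hasDerivAt τ e1
    have e3 := e2.clm_apply e1
    rw [S.symm τ (u τ - w) u', ← two_mul] at e3
    exact e3
  have lslope := (hasDerivAt_iff_tendsto_slope.1 hder).mono_left
    (nhdsWithin_mono τ (fun s (hs : τ < s) => ne_of_gt hs) : 𝓝[>] τ ≤ 𝓝[≠] τ)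
  -- The bound of `hint` divided by `s - τ`, to be compared with the difference quotient as `s ↘ τ`.
  have hcR : Continuous fun s : ℝ => 2 * ((Real.exp (C * (s - τ)) * (E τ w).toReal -
      Real.exp (-(C * (s - τ))) * m + K * (s - τ) * R * η⁻¹) + K * R * η * M) := by fun_prop
  have lR := (hcR.tendsto τ).mono_left (nhdsWithin_le_nhds (s := Ioi τ))
  simp only [sub_self, mul_zero, neg_zero, Real.exp_zero, one_mul, zero_mul, add_zero] at lR
  have hfinal := le_of_tendsto_of_tendsto lslope lR (by
    filter_upwards [Ioo_mem_nhdsGT (show τ < min T (τ + ρ) from lt_min hτ.2 (by linarith))] with s hs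
    have hs1 := hs.2.trans_le (min_le_left _ _)
    have hs2 := hs.2.trans_le (min_le_right _ _)
    rw [slope_def_field, div_le_iff₀ (sub_pos.2 hs.1)]
    refine (hint s hs.1 hs1 (by linarith)).trans (le_of_eq ?_)
    ring)
  linarith

end EvolvingEnergy

end DynamicCheeger

/-! ### Existence and uniqueness of the abstract flow. -/

namespace DynamicCheeger

variable {H : Type*} [NormedAddCommGroup H] [InnerProductSpace ℝ H]
  {E : ℝ → H → ℝ≥0∞} {B : ℝ → H →L[ℝ] H →L[ℝ] ℝ} {C c K : ℝ}

/-- `-p` is a subgradient at `u` of the energy `e` with respect to the scalar product `b`. -/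
def IsDescentDirection (e : H → ℝ≥0∞) (b : H →L[ℝ] H →L[ℝ] ℝ) (u p : H) : Prop :=
  e u ≠ ⊤ ∧ ∀ w, e w ≠ ⊤ → b p (u - w) ≤ (e w).toReal - (e u).toReal

namespace EvolvingEnergy

theorem exists_flow [CompleteSpace H] (S : EvolvingEnergy E B C c K) {u₀ : H} (hu₀ : E 0 u₀ ≠ ⊤)
    {T : ℝ} (hT : 0 < T) :
    ∃ u : ℝ → H, AbsolutelyContinuousOnInterval u 0 T ∧ u 0 = u₀ ∧
      (∀ᵐ t : ℝ, t ∈ Ioo 0 T → ∃ u', HasDerivAt u u' t ∧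
        IsDescentDirection (E t) (B t) (u t) u') ∧
      ∀ t ∈ Ico 0 T, E t (u t) ≠ ⊤ := by
  set M := energyBound E C c T u₀ with hMdef
  have hM : 0 ≤ M := S.energyBound_nonneg T u₀
  let h : ℕ → ℝ := fun n => 1 / ((n : ℝ) + 1)
  have h0 : ∀ n, 0 < h n := fun n => by positivity
  have h1 : ∀ n, h n ≤ 1 := fun n => by
    simp only [h]
    rw [div_le_one (by positivity)]
    linarith [n.cast_nonneg (α := ℝ)]
  have hlim : Tendsto h atTop (𝓝 0) := tendsto_one_div_add_atTop_nhds_zero_nat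
  choose U V W a A using fun n => S.exists_isApproxFlow hu₀ hT (h0 n) (h1 n)
  obtain ⟨Λ, hΛ, hcmp⟩ := S.exists_sq_norm_sub_le u₀ hT hM
  have hUU : ∀ n m, ∀ t ∈ Icc 0 T, ‖U n t - U m t‖ ^ 2 ≤ Λ * (h n + h m) := fun n m t ht =>
    hcmp (A n) (A m) (h0 n) (h1 n) (h0 m) (h1 m) t ht
  have hcauchy : ∀ t ∈ Icc 0 T, CauchySeq fun n => U n t := by
    intro t ht
    rw [Metric.cauchySeq_iff]
    intro ε hε
    have hl : Tendsto (fun n => Λ * (h n + h n)) atTop (𝓝 0) := by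
      simpa using (hlim.add hlim).const_mul Λ
    obtain ⟨N, hN⟩ := (hl.eventually (gt_mem_nhds (show 0 < ε ^ 2 by positivity))).exists
    refine ⟨N, fun n hn m hm => ?_⟩
    have hanti : ∀ k, N ≤ k → h k ≤ h N := fun k hk => by
      simp only [h]
      gcongr
    rw [dist_eq_norm]
    refine lt_of_pow_lt_pow_left₀ 2 hε.le ((hUU n m t ht).trans_lt (lt_of_le_of_lt ?_ hN))
    exact mul_le_mul_of_nonneg_left (add_le_add (hanti n hn) (hanti m hm)) hΛ
  choose! x hx using fun t ht => cauchySeq_tendsto_of_complete (hcauchy t ht)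
  obtain ⟨v, hv, hxv⟩ := exists_integral_eq_of_tendsto hT.le (fun n => (A n).integrable)
    (fun n => (A n).integrable_sq) (fun n => (A n).energy) (u := fun t => x t - u₀) (fun t ht => by
      have := (hx t ht).sub_const u₀
      simpa only [(A _).eq_integral, add_sub_cancel_left] using this)
  -- The limit `x` is controlled only on `[0, T]`; its primitive form supplies absolute continuity
  -- and a.e. derivatives.
  let u : ℝ → H := fun t => u₀ + ∫ s in (0 : ℝ)..t, v s
  have hxu : ∀ t ∈ Icc 0 T, x t = u t := fun t ht => by
    simp only [u]
    rw [← hxv t ht]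
    abel
  have hUu : ∀ n, ∀ t ∈ Icc 0 T, ‖U n t - u t‖ ^ 2 ≤ Λ * h n := by
    intro n t ht
    have l1 : Tendsto (fun m => ‖U n t - U m t‖ ^ 2) atTop (𝓝 (‖U n t - u t‖ ^ 2)) :=
      ((hxu t ht ▸ hx t ht).const_sub (U n t)).norm.pow 2
    have l2 : Tendsto (fun m => Λ * (h n + h m)) atTop (𝓝 (Λ * h n)) := by
      simpa using (hlim.const_add (h n)).const_mul Λ
    exact le_of_tendsto_of_tendsto' l1 l2 fun m => hUU n m t ht
  -- The energy bound holds at `W n t`, which also tends to `u t`. Moving from time `a n t` to `t`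
  -- costs at most `e^C`, since `h n ≤ 1`.
  have hfin : ∀ t ∈ Ico 0 T, E t (u t) ≠ ⊤ := by
    intro t ht
    have hUt : Tendsto (fun n => U n t) atTop (𝓝 (u t)) :=
      hxu t (Ico_subset_Icc_self ht) ▸ hx t (Ico_subset_Icc_self ht)
    have hWU : Tendsto (fun n => W n t - U n t) atTop (𝓝 0) := by
      rw [tendsto_zero_iff_norm_tendsto_zero]
      have h2 : Tendsto (fun n => ‖W n t - U n t‖ ^ 2) atTop (𝓝 0) :=
        squeeze_zero (fun n => sq_nonneg _) (fun n => (A n).sq_norm_sub_le (h0 n) ht)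
          (by simpa using hlim.mul_const M)
      simpa [Real.sqrt_sq (norm_nonneg _)] using h2.sqrt
    have hWt : Tendsto (fun n => W n t) atTop (𝓝 (u t)) := by
      simpa using hWU.add hUt
    refine ne_top_of_le_ne_top ENNReal.ofReal_ne_top
      (S.energy_le_of_tendsto hWt (b := ENNReal.ofReal (Real.exp C * M)) ?_)
    refine Eventually.of_forall fun n => ?_
    have f1 := (A n).ne_top t ht
    rw [← ENNReal.ofReal_toReal (S.ne_top f1 t)]
    refine ENNReal.ofReal_le_ofReal ((S.toReal_le f1 t).trans ?_)
    have m1 := (A n).time_mem t ht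
    have : |t - a n t| ≤ 1 := by
      rw [abs_le]
      constructor <;> linarith [m1.1, m1.2, h1 n]
    have hC := S.C_nonneg
    gcongr
    · nlinarith
    · exact (A n).energy_le t ht
  refine ⟨u, absolutelyContinuousOnInterval_integral hv u₀, by simp [u], ?_, hfin⟩
  filter_upwards [hv.ae_hasDerivAt_integral] with t ht htT
  have ht' : t ∈ uIcc 0 T := by
    rw [uIcc_of_le hT.le]
    exact Ioo_subset_Icc_self htT
  have hd : HasDerivAt u (v t) t := (ht ht' 0 left_mem_uIcc).const_add u₀
  have hf := hfin t (Ioo_subset_Ico_self htT)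
  exact ⟨v t, hd, hf, fun w hw => S.subgradient_of_limit hM A h0 h1 hlim hUu htT hd hf hw⟩

/-- Testing each inclusion at the other curve gives `B t (u' - v') (u - v) ≤ 0`, which is Grönwall
with `φ = 0`. -/
theorem flow_unique (S : EvolvingEnergy E B C c K) {T : ℝ} (hT : 0 < T) {u v : ℝ → H}
    (hu : AbsolutelyContinuousOnInterval u 0 T) (hv : AbsolutelyContinuousOnInterval v 0 T)
    (h0 : u 0 = v 0)
    (hu' : ∀ᵐ t : ℝ, t ∈ Ioo 0 T → ∃ u', HasDerivAt u u' t ∧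
      IsDescentDirection (E t) (B t) (u t) u')
    (hv' : ∀ᵐ t : ℝ, t ∈ Ioo 0 T → ∃ v', HasDerivAt v v' t ∧
      IsDescentDirection (E t) (B t) (v t) v') :
    EqOn u v (Icc 0 T) := by
  intro t ht
  have key := S.sq_norm_le_of_deriv_le hT.le (hu.fun_sub hv) (by simp [h0]) (φ := fun _ => 0)
    intervalIntegrable_const (fun _ => le_rfl) (by
      filter_upwards [hu', hv'] with s h1 h2 hs
      obtain ⟨u', hud, huf, hus⟩ := h1 hs
      obtain ⟨v', hvd, hvf, hvs⟩ := h2 hs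
      refine ⟨u' - v', hud.fun_sub hvd, ?_⟩
      have e1 := hus (v s) hvf
      have e2 := hvs (u s) huf
      simp only [map_sub, _root_.sub_apply] at e1 e2 ⊢
      linarith) ht
  simp only [intervalIntegral.integral_zero, mul_zero] at key
  have hc := S.c_pos
  have : ‖u t - v t‖ ^ 2 ≤ 0 := nonpos_of_mul_nonpos_right key hc
  have : ‖u t - v t‖ = 0 := by
    have := le_antisymm this (sq_nonneg _)
    exact pow_eq_zero_iff two_ne_zero |>.1 this
  exact sub_eq_zero.1 (norm_eq_zero.1 this)

end EvolvingEnergy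

end DynamicCheeger

/-! ### The local slope. -/

namespace DynamicCheeger

lemma limsup_add_le_ennreal {ι : Type*} {F : Filter ι} (u v : ι → ℝ≥0∞) :
    limsup (fun i => u i + v i) F ≤ limsup u F + limsup v F := by
  refine ENNReal.le_of_forall_pos_le_add fun ε hε hfin => ?_
  have hε' : (0 : ℝ≥0∞) < (ε / 2 : NNReal) := by exact_mod_cast half_pos hε
  obtain ⟨hu, hv⟩ := ENNReal.add_lt_top.1 hfin
  have e1 := eventually_lt_of_limsup_lt (ENNReal.lt_add_right hu.ne hε'.ne')
  have e2 := eventually_lt_of_limsup_lt (ENNReal.lt_add_right hv.ne hε'.ne')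
  refine limsup_le_of_le (by isBoundedDefault) ?_
  filter_upwards [e1, e2] with i h1 h2
  refine (add_le_add h1.le h2.le).trans (le_of_eq ?_)
  rw [add_add_add_comm, ← ENNReal.coe_add, add_halves]

lemma convex_combination_sq_le {a b : ℝ≥0∞} (hab : a + b = 1) (x y : ℝ≥0∞) :
    (a * x + b * y) ^ 2 ≤ a * x ^ 2 + b * y ^ 2 := by
  have := ENNReal.rpow_arith_mean_le_arith_mean2_rpow a b x y hab (p := 2) (by norm_num)
  simpa only [ENNReal.rpow_two] using this

lemma add_sq_le_ennreal (x y : ℝ≥0∞) : (x + y) ^ 2 ≤ 2 * x ^ 2 + 2 * y ^ 2 := by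
  have := ENNReal.rpow_add_le_mul_rpow_add_rpow x y (p := 2) (by norm_num)
  rw [← mul_add]
  simpa only [ENNReal.rpow_two, show (2 : ℝ) - 1 = 1 by norm_num, ENNReal.rpow_one] using this

section Slope

variable {X : Type*}

lemma isLip_continuous [m : MetricSpace X] {u : X → ℝ} (hu : IsLip m u) : Continuous u := by
  obtain ⟨K, hK⟩ := hu
  refine LipschitzWith.continuous (K := K.toNNReal) (LipschitzWith.of_dist_le_mul fun x y => ?_)
  rw [Real.dist_eq]
  refine (hK x y).trans ?_
  gcongr
  exact Real.le_coe_toNNReal K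

/-- The limsup is a countable infimum of suprema over `y`. With `y` fixed, the quotient, cut off to
the open set of `x ≠ y` in a ball around `y`, is lower semicontinuous in `x`, a property that
survives the uncountable supremum. -/
lemma measurable_localSlope_of_metricSpace [m : MetricSpace X] [MeasurableSpace X] [BorelSpace X]
    {u : X → ℝ} (hu : Continuous u) : Measurable (localSlope m u) := by
  have heq : localSlope m u = fun x => ⨅ n : ℕ, ⨆ y : X,
      (Metric.ball y (1 / ((n : ℝ) + 1)) ∩ {y}ᶜ).indicator
        (fun x => ENNReal.ofReal (|u x - u y| / dist x y)) x := by
    funext x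
    have hb := nhdsWithin_hasBasis (Metric.nhds_basis_ball_inv_nat_succ (x := x)) {x}ᶜ
    rw [localSlope, hb.limsup_eq_iInf_iSup]
    simp only [iInf_true]
    refine iInf_congr fun n => iSup_congr fun y => ?_
    by_cases hy : y ∈ Metric.ball x (1 / ((n : ℝ) + 1)) ∩ {x}ᶜ
    · have hx : x ∈ Metric.ball y (1 / ((n : ℝ) + 1)) ∩ {y}ᶜ :=
        ⟨Metric.mem_ball_comm.1 hy.1, fun h => hy.2 (Eq.symm h)⟩
      rw [indicator_of_mem hx, iSup_pos hy]
    · have hx : x ∉ Metric.ball y (1 / ((n : ℝ) + 1)) ∩ {y}ᶜ := fun h =>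
        hy ⟨Metric.mem_ball_comm.1 h.1, fun h' => h.2 (Eq.symm h')⟩
      rw [indicator_of_notMem hx, iSup_neg hy, bot_eq_zero]
  rw [heq]
  refine Measurable.iInf fun n => LowerSemicontinuous.measurable (lowerSemicontinuous_iSup fun y => ?_)
  have hopen : IsOpen (Metric.ball y (1 / ((n : ℝ) + 1)) ∩ {y}ᶜ) :=
    Metric.isOpen_ball.inter isOpen_compl_singleton
  intro x c hc
  by_cases hx : x ∈ Metric.ball y (1 / ((n : ℝ) + 1)) ∩ {y}ᶜ
  · rw [indicator_of_mem hx] at hc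
    have hcont : ContinuousAt (fun x => ENNReal.ofReal (|u x - u y| / dist x y)) x := by
      refine ENNReal.continuous_ofReal.continuousAt.comp ?_
      refine ContinuousAt.div (by fun_prop) (by fun_prop) ?_
      exact dist_ne_zero.2 hx.2
    filter_upwards [hcont.eventually (lt_mem_nhds hc), hopen.mem_nhds hx] with z hz hz'
    rwa [indicator_of_mem hz']
  · rw [indicator_of_notMem hx] at hc
    exact absurd hc not_lt_zero

lemma localSlope_combination_le (ρ : MetricSpace X) (u v : X → ℝ) {a b : ℝ} (ha : 0 ≤ a)
    (hb : 0 ≤ b) (x : X) :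
    localSlope ρ (fun y => a * u y + b * v y) x ≤
      ENNReal.ofReal a * localSlope ρ u x + ENNReal.ofReal b * localSlope ρ v x := by
  unfold localSlope
  rw [← ENNReal.limsup_const_mul_of_ne_top ENNReal.ofReal_ne_top,
    ← ENNReal.limsup_const_mul_of_ne_top ENNReal.ofReal_ne_top]
  refine le_trans (limsup_le_limsup (Eventually.of_forall fun y => ?_)) (limsup_add_le_ennreal _ _)
  have hd : 0 ≤ ρ.dist x y := @dist_nonneg X ρ.toPseudoMetricSpace x y
  rw [← ENNReal.ofReal_mul ha, ← ENNReal.ofReal_mul hb,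
    ← ENNReal.ofReal_add (by positivity) (by positivity)]
  refine ENNReal.ofReal_le_ofReal ?_
  rw [← mul_div_assoc, ← mul_div_assoc, ← add_div]
  gcongr
  calc |a * u x + b * v x - (a * u y + b * v y)| = |a * (u x - u y) + b * (v x - v y)| := by ring_nf
    _ ≤ |a * (u x - u y)| + |b * (v x - v y)| := abs_add_le _ _
    _ = _ := by rw [abs_mul, abs_mul, abs_of_nonneg ha, abs_of_nonneg hb]

lemma isLip_combination {ρ : MetricSpace X} {u v : X → ℝ} (hu : IsLip ρ u) (hv : IsLip ρ v)
    {a b : ℝ} (ha : 0 ≤ a) (hb : 0 ≤ b) : IsLip ρ fun y => a * u y + b * v y := by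
  obtain ⟨K, hK⟩ := hu
  obtain ⟨K', hK'⟩ := hv
  refine ⟨a * K + b * K', fun x y => ?_⟩
  calc |a * u x + b * v x - (a * u y + b * v y)| = |a * (u x - u y) + b * (v x - v y)| := by ring_nf
    _ ≤ |a * (u x - u y)| + |b * (v x - v y)| := abs_add_le _ _
    _ = a * |u x - u y| + b * |v x - v y| := by
      rw [abs_mul, abs_mul, abs_of_nonneg ha, abs_of_nonneg hb]
    _ ≤ a * (K * ρ.dist x y) + b * (K' * ρ.dist x y) := by
      gcongr
      · exact hK x y
      · exact hK' x y
    _ = _ := by ring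

lemma localSlope_le_of_dist_le {ρ ρ' : MetricSpace X}
    (hρ : ρ.toUniformSpace.toTopologicalSpace = ρ'.toUniformSpace.toTopologicalSpace)
    {k : ℝ} (hk : 0 < k) (hd : ∀ x y, ρ.dist x y ≤ k * ρ'.dist x y) (u : X → ℝ) (x : X) :
    localSlope ρ' u x ≤ ENNReal.ofReal k * localSlope ρ u x := by
  unfold localSlope
  rw [← ENNReal.limsup_const_mul_of_ne_top ENNReal.ofReal_ne_top, hρ]
  refine limsup_le_limsup ?_
  filter_upwards [@self_mem_nhdsWithin X ρ'.toUniformSpace.toTopologicalSpace x {x}ᶜ] with y hy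
  rw [← ENNReal.ofReal_mul hk.le]
  refine ENNReal.ofReal_le_ofReal ?_
  have hxy : x ≠ y := fun h => hy (Eq.symm h)
  have h1 : 0 < ρ.dist x y := (@dist_pos X ρ x y).2 hxy
  have h2 : 0 < ρ'.dist x y := (@dist_pos X ρ' x y).2 hxy
  rw [← mul_div_assoc, div_le_div_iff₀ h2 h1]
  have := mul_le_mul_of_nonneg_left (hd x y) (abs_nonneg (u x - u y))
  linarith

lemma isLip_of_dist_le {ρ ρ' : MetricSpace X} {k : ℝ}
    (hd : ∀ x y, ρ.dist x y ≤ k * ρ'.dist x y) {u : X → ℝ} (hu : IsLip ρ u) : IsLip ρ' u := by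
  obtain ⟨K, hK⟩ := hu
  refine ⟨|K| * k, fun x y => (hK x y).trans ?_⟩
  have hd0 : 0 ≤ ρ.dist x y := @dist_nonneg X ρ.toPseudoMetricSpace x y
  calc K * ρ.dist x y ≤ |K| * ρ.dist x y := by gcongr; exact le_abs_self K
    _ ≤ |K| * (k * ρ'.dist x y) := by gcongr; exact hd x y
    _ = _ := by ring

variable [τ : TopologicalSpace X] [MeasurableSpace X] [BorelSpace X]

lemma measurable_localSlope {ρ : MetricSpace X} (hρ : ρ.toUniformSpace.toTopologicalSpace = τ)
    {u : X → ℝ} (hu : IsLip ρ u) : Measurable (localSlope ρ u) := by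
  subst hρ
  exact measurable_localSlope_of_metricSpace (isLip_continuous hu)

lemma measurable_of_isLip {ρ : MetricSpace X} (hρ : ρ.toUniformSpace.toTopologicalSpace = τ)
    {u : X → ℝ} (hu : IsLip ρ u) : Measurable u := by
  subst hρ
  exact (isLip_continuous hu).measurable

end Slope

end DynamicCheeger

/-! ### Cheeger's energy: convexity, lower semicontinuity, dependence on metric and measure. -/

namespace DynamicCheeger

section Cheeger

variable {X : Type*} [MeasurableSpace X]

/-- Replaces sequences by single `ε`-approximants, which makes the diagonal arguments below
immediate. For `c = ⊤` the right side would still demand a Lipschitz approximant. -/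
lemma cheeger_le_iff (ρ : MetricSpace X) (μ : Measure X) (u : X → ℝ) {c : ℝ≥0∞} (hc : c ≠ ⊤) :
    cheeger ρ μ u ≤ c ↔ ∀ ε : ℝ≥0∞, 0 < ε → ∃ w, IsLip ρ w ∧ ∫⁻ x, ‖w x - u x‖ₑ ^ 2 ∂μ ≤ ε ∧
      ∫⁻ x, localSlope ρ w x ^ 2 ∂μ ≤ 2 * c + ε := by
  have htop : 2 * c ≠ ⊤ := ENNReal.mul_ne_top (by simp) hc
  have hiff : cheeger ρ μ u ≤ c ↔ (⨅ (w : ℕ → X → ℝ) (_ : ∀ n, IsLip ρ (w n))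
      (_ : Tendsto (fun n => ∫⁻ x, ‖w n x - u x‖ₑ ^ 2 ∂μ) atTop (𝓝 0)),
      liminf (fun n => ∫⁻ x, localSlope ρ (w n) x ^ 2 ∂μ) atTop) ≤ 2 * c := by
    rw [cheeger, one_div, ENNReal.inv_mul_le_iff (by simp) (by simp)]
  rw [hiff]
  constructor
  · intro h ε hε
    have hlt := h.trans_lt (ENNReal.lt_add_right htop hε.ne')
    simp only [iInf_lt_iff] at hlt
    obtain ⟨w, hw, hlim, hlt⟩ := hlt
    obtain ⟨n, hn1, hn2⟩ := ((frequently_lt_of_liminf_lt (by isBoundedDefault) hlt).and_eventually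
      (hlim.eventually (ge_mem_nhds hε))).exists
    exact ⟨w n, hw n, hn2, hn1.le⟩
  · intro h
    have hpos : ∀ n : ℕ, (0 : ℝ≥0∞) < ((n : ℝ≥0∞) + 1)⁻¹ := fun n =>
      ENNReal.inv_pos.2 (by simp)
    have hl : Tendsto (fun n : ℕ => ((n : ℝ≥0∞) + 1)⁻¹) atTop (𝓝 0) := by
      have := (tendsto_add_atTop_iff_nat 1).2 ENNReal.tendsto_inv_nat_nhds_zero
      simpa using this
    choose w hw hd hJ using fun n : ℕ => h _ (hpos n)
    refine iInf_le_of_le w (iInf_le_of_le hw (iInf_le_of_le ?_ ?_))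
    · exact tendsto_of_tendsto_of_tendsto_of_le_of_le tendsto_const_nhds hl (fun _ => zero_le) hd
    · have h3 : Tendsto (fun n : ℕ => 2 * c + ((n : ℝ≥0∞) + 1)⁻¹) atTop (𝓝 (2 * c)) := by
        simpa using hl.const_add (2 * c)
      rw [← h3.liminf_eq]
      exact liminf_le_liminf (Eventually.of_forall hJ)

lemma cheeger_congr_ae (ρ : MetricSpace X) {μ : Measure X} {u v : X → ℝ} (h : u =ᵐ[μ] v) :
    cheeger ρ μ u = cheeger ρ μ v := by
  have : ∀ w : X → ℝ, ∫⁻ x, ‖w x - u x‖ₑ ^ 2 ∂μ = ∫⁻ x, ‖w x - v x‖ₑ ^ 2 ∂μ := fun w =>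
    lintegral_congr_ae (by filter_upwards [h] with x hx; rw [hx])
  simp only [cheeger, this]

/-- Sequences admissible for `(ρ, μ)` remain admissible for `(ρ', μ')`; `k²` comes from the squared
slope and `q` from the measure. -/
lemma cheeger_le_of_dist_le {ρ ρ' : MetricSpace X}
    (hρ : ρ.toUniformSpace.toTopologicalSpace = ρ'.toUniformSpace.toTopologicalSpace)
    {k : ℝ} (hk : 0 < k) (hd : ∀ x y, ρ.dist x y ≤ k * ρ'.dist x y) {μ μ' : Measure X} {q : ℝ}
    (hq : 0 < q) (hμ : μ' ≤ ENNReal.ofReal q • μ) (u : X → ℝ) :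
    cheeger ρ' μ' u ≤ ENNReal.ofReal (k ^ 2 * q) * cheeger ρ μ u := by
  set κ := ENNReal.ofReal (k ^ 2 * q) with hκ
  have hκ0 : κ ≠ 0 := by
    rw [hκ, Ne, ENNReal.ofReal_eq_zero, not_le]
    positivity
  have hκt : κ ≠ ⊤ := ENNReal.ofReal_ne_top
  have hint : ∀ g : X → ℝ≥0∞, ∫⁻ x, g x ∂μ' ≤ ENNReal.ofReal q * ∫⁻ x, g x ∂μ := fun g => by
    refine (lintegral_mono' hμ le_rfl).trans (le_of_eq ?_)
    rw [lintegral_smul_measure, smul_eq_mul]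
  unfold cheeger
  rw [mul_left_comm]
  refine mul_le_mul_right ?_ _
  rw [mul_comm κ, ← ENNReal.div_le_iff hκ0 hκt]
  refine le_iInf fun w => le_iInf fun hw => le_iInf fun hlim => ?_
  rw [ENNReal.div_le_iff hκ0 hκt]
  refine iInf_le_of_le w (iInf_le_of_le (fun n => isLip_of_dist_le hd (hw n)) (iInf_le_of_le ?_ ?_))
  · have : Tendsto (fun n => ENNReal.ofReal q * ∫⁻ x, ‖w n x - u x‖ₑ ^ 2 ∂μ) atTop (𝓝 0) := by
      simpa using ENNReal.Tendsto.const_mul hlim (Or.inr (@ENNReal.ofReal_ne_top q))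
    exact tendsto_of_tendsto_of_tendsto_of_le_of_le tendsto_const_nhds this (fun _ => zero_le)
      fun n => hint _
  · rw [mul_comm, ← ENNReal.liminf_const_mul_of_ne_top hκt]
    refine liminf_le_liminf (Eventually.of_forall fun n => ?_)
    calc ∫⁻ x, localSlope ρ' (w n) x ^ 2 ∂μ'
        ≤ ∫⁻ x, (ENNReal.ofReal k) ^ 2 * localSlope ρ (w n) x ^ 2 ∂μ' := by
          refine lintegral_mono fun x => ?_
          rw [← mul_pow]
          gcongr
          exact localSlope_le_of_dist_le hρ hk hd _ _
      _ = (ENNReal.ofReal k) ^ 2 * ∫⁻ x, localSlope ρ (w n) x ^ 2 ∂μ' :=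
          lintegral_const_mul' _ _ (by simp)
      _ ≤ (ENNReal.ofReal k) ^ 2 * (ENNReal.ofReal q * ∫⁻ x, localSlope ρ (w n) x ^ 2 ∂μ) := by
          gcongr
          exact hint _
      _ = κ * ∫⁻ x, localSlope ρ (w n) x ^ 2 ∂μ := by
          rw [← mul_assoc, ← ENNReal.ofReal_pow hk.le, ← ENNReal.ofReal_mul (by positivity)]

variable [τ : TopologicalSpace X] [BorelSpace X]

lemma cheeger_convex {ρ : MetricSpace X} (hρ : ρ.toUniformSpace.toTopologicalSpace = τ)
    {μ : Measure X} {u v : X → ℝ} (hu : AEMeasurable u μ) {a b : ℝ}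
    (ha : 0 ≤ a) (hb : 0 ≤ b) (hab : a + b = 1) :
    cheeger ρ μ (fun x => a * u x + b * v x) ≤
      ENNReal.ofReal a * cheeger ρ μ u + ENNReal.ofReal b * cheeger ρ μ v := by
  -- Zero weights are split off because `0 * ⊤ = 0`; with positive weights an infinite energy makes
  -- the right side infinite.
  rcases ha.eq_or_lt with rfl | ha'
  · obtain rfl : b = 1 := by linarith
    simp
  rcases hb.eq_or_lt with rfl | hb'
  · obtain rfl : a = 1 := by linarith
    simp
  by_cases hfu : cheeger ρ μ u = ⊤
  · rw [hfu, ENNReal.mul_top (by simpa using ha')]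
    simp
  by_cases hfv : cheeger ρ μ v = ⊤
  · rw [hfv, ENNReal.mul_top (by simpa using hb')]
    simp
  have hab' : ENNReal.ofReal a + ENNReal.ofReal b = 1 := by
    rw [← ENNReal.ofReal_add ha hb, hab, ENNReal.ofReal_one]
  rw [cheeger_le_iff ρ μ _ (by finiteness)]
  intro ε hε
  obtain ⟨w, hw, hwd, hwJ⟩ := (cheeger_le_iff ρ μ u hfu).1 le_rfl ε hε
  obtain ⟨z, hz, hzd, hzJ⟩ := (cheeger_le_iff ρ μ v hfv).1 le_rfl ε hε
  have hcomb : ∀ x : ℝ≥0∞, ENNReal.ofReal a * x + ENNReal.ofReal b * x = x := fun x => by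
    rw [← add_mul, hab', one_mul]
  refine ⟨_, isLip_combination hw hz ha hb, ?_, ?_⟩
  · calc ∫⁻ x, ‖a * w x + b * z x - (a * u x + b * v x)‖ₑ ^ 2 ∂μ
        ≤ ∫⁻ x, (ENNReal.ofReal a * ‖w x - u x‖ₑ ^ 2 +
            ENNReal.ofReal b * ‖z x - v x‖ₑ ^ 2) ∂μ := by
          refine lintegral_mono fun x => ?_
          refine le_trans ?_ (convex_combination_sq_le hab' _ _)
          gcongr
          calc ‖a * w x + b * z x - (a * u x + b * v x)‖ₑ
              = ‖a * (w x - u x) + b * (z x - v x)‖ₑ := by ring_nf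
            _ ≤ ‖a * (w x - u x)‖ₑ + ‖b * (z x - v x)‖ₑ := enorm_add_le _ _
            _ = _ := by
              rw [enorm_mul, enorm_mul, Real.enorm_of_nonneg ha, Real.enorm_of_nonneg hb]
      _ = ENNReal.ofReal a * ∫⁻ x, ‖w x - u x‖ₑ ^ 2 ∂μ +
            ENNReal.ofReal b * ∫⁻ x, ‖z x - v x‖ₑ ^ 2 ∂μ := by
          rw [lintegral_add_left', lintegral_const_mul' _ _ ENNReal.ofReal_ne_top,
            lintegral_const_mul' _ _ ENNReal.ofReal_ne_top]
          exact ((((measurable_of_isLip hρ hw).aemeasurable.sub hu).enorm).pow_const 2).const_mul _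
      _ ≤ ENNReal.ofReal a * ε + ENNReal.ofReal b * ε := by gcongr
      _ = ε := hcomb ε
  · calc ∫⁻ x, localSlope ρ (fun y => a * w y + b * z y) x ^ 2 ∂μ
        ≤ ∫⁻ x, (ENNReal.ofReal a * localSlope ρ w x ^ 2 +
            ENNReal.ofReal b * localSlope ρ z x ^ 2) ∂μ := by
          refine lintegral_mono fun x => ?_
          refine le_trans ?_ (convex_combination_sq_le hab' _ _)
          gcongr
          exact localSlope_combination_le ρ w z ha hb x
      _ = ENNReal.ofReal a * ∫⁻ x, localSlope ρ w x ^ 2 ∂μ +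
            ENNReal.ofReal b * ∫⁻ x, localSlope ρ z x ^ 2 ∂μ := by
          rw [lintegral_add_left, lintegral_const_mul' _ _ ENNReal.ofReal_ne_top,
            lintegral_const_mul' _ _ ENNReal.ofReal_ne_top]
          exact ((measurable_localSlope hρ hw).pow_const 2).const_mul _
      _ ≤ ENNReal.ofReal a * (2 * cheeger ρ μ u + ε) +
            ENNReal.ofReal b * (2 * cheeger ρ μ v + ε) := by gcongr
      _ = 2 * (ENNReal.ofReal a * cheeger ρ μ u + ENNReal.ofReal b * cheeger ρ μ v) +
            (ENNReal.ofReal a * ε + ENNReal.ofReal b * ε) := by ring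
      _ = _ := by rw [hcomb ε]

/-- A good approximant of `v n` also approximates `u`. The choice `ε/4` absorbs the factor in
`(x+y)² ≤ 2x² + 2y²`, applied to two errors. -/
lemma cheeger_le_of_tendsto {ρ : MetricSpace X} (hρ : ρ.toUniformSpace.toTopologicalSpace = τ)
    {μ : Measure X} {u : X → ℝ} {v : ℕ → X → ℝ} (hv : ∀ n, AEMeasurable (v n) μ)
    (hlim : Tendsto (fun n => ∫⁻ x, ‖v n x - u x‖ₑ ^ 2 ∂μ) atTop (𝓝 0)) {c : ℝ≥0∞}
    (hc : ∀ n, cheeger ρ μ (v n) ≤ c) : cheeger ρ μ u ≤ c := by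
  by_cases hct : c = ⊤
  · rw [hct]; exact le_top
  rw [cheeger_le_iff ρ μ u hct]
  intro ε hε
  have hε4 : 0 < ε / 4 := ENNReal.div_pos hε.ne' (by simp)
  obtain ⟨n, hn⟩ := (hlim.eventually (ge_mem_nhds hε4)).exists
  obtain ⟨w, hw, hwd, hwJ⟩ := (cheeger_le_iff ρ μ (v n) hct).1 (hc n) (ε / 4) hε4
  have h4 : ε / 4 ≤ ε := ENNReal.div_le_of_le_mul (le_mul_of_one_le_right zero_le (by norm_num))
  refine ⟨w, hw, ?_, hwJ.trans (by gcongr)⟩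
  calc ∫⁻ x, ‖w x - u x‖ₑ ^ 2 ∂μ
      ≤ ∫⁻ x, (2 * ‖w x - v n x‖ₑ ^ 2 + 2 * ‖v n x - u x‖ₑ ^ 2) ∂μ := by
        refine lintegral_mono fun x => le_trans ?_ (add_sq_le_ennreal _ _)
        gcongr
        calc ‖w x - u x‖ₑ = ‖(w x - v n x) + (v n x - u x)‖ₑ := by ring_nf
          _ ≤ _ := enorm_add_le _ _
    _ = 2 * ∫⁻ x, ‖w x - v n x‖ₑ ^ 2 ∂μ + 2 * ∫⁻ x, ‖v n x - u x‖ₑ ^ 2 ∂μ := by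
        rw [lintegral_add_left', lintegral_const_mul' _ _ (by simp),
          lintegral_const_mul' _ _ (by simp)]
        exact ((((measurable_of_isLip hρ hw).aemeasurable.sub (hv n)).enorm).pow_const 2).const_mul _
    _ ≤ 2 * (ε / 4) + 2 * (ε / 4) := by gcongr
    _ = 4 * (ε / 4) := by ring
    _ = ε := ENNReal.mul_div_cancel (by simp) (by simp)

end Cheeger

end DynamicCheeger

/-! ### Scalar products with densities; Cheeger's energies form an `EvolvingEnergy`. -/

namespace DynamicCheeger

section Form

variable {X : Type*} [MeasurableSpace X] {μ : Measure X}

lemma integrable_density_mul {θ : X → ℝ} (hθ : Measurable θ) {k : ℝ} (hk : ∀ x, |θ x| ≤ k)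
    (v w : Lp ℝ 2 μ) : Integrable (fun x => θ x * (v x * w x)) μ := by
  have h1 : Integrable (fun x => v x * w x) μ := (Lp.memLp v).integrable_mul (Lp.memLp w)
  exact h1.bdd_mul (c := k) hθ.aestronglyMeasurable (Eventually.of_forall hk)

lemma abs_integral_density_mul_le {θ : X → ℝ} (hθ : Measurable θ) {k : ℝ} (hk : ∀ x, |θ x| ≤ k)
    (v w : Lp ℝ 2 μ) : |∫ x, θ x * (v x * w x) ∂μ| ≤ k * ‖v‖ * ‖w‖ := by
  have hbd : ∀ x, ‖θ x * v x‖ ≤ k * ‖v x‖ := fun x => by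
    rw [norm_mul]
    gcongr
    exact hk x
  have hmem : MemLp (fun x => θ x * v x) 2 μ :=
    (Lp.memLp v).of_le_mul (hθ.aestronglyMeasurable.mul (Lp.aestronglyMeasurable v))
      (Eventually.of_forall hbd)
  have hnorm : ‖hmem.toLp‖ ≤ k * ‖v‖ := by
    refine Lp.norm_le_mul_norm_of_ae_le_mul ?_
    filter_upwards [hmem.coeFn_toLp] with x hx
    rw [hx]
    exact hbd x
  have heq : ∫ x, θ x * (v x * w x) ∂μ = inner ℝ hmem.toLp w := by
    rw [L2.inner_def]
    refine integral_congr_ae ?_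
    filter_upwards [hmem.coeFn_toLp] with x hx
    rw [hx]
    simp only [RCLike.inner_apply, conj_trivial]
    ring
  rw [heq]
  exact (abs_real_inner_le_norm _ _).trans (by gcongr)

/-- The bounded bilinear form `(v, w) ↦ ∫ θ v w dμ` on `L²(μ)`. -/
noncomputable def densityForm (μ : Measure X) (θ : X → ℝ) (k : ℝ) (hθ : Measurable θ)
    (hk : ∀ x, |θ x| ≤ k) : Lp ℝ 2 μ →L[ℝ] Lp ℝ 2 μ →L[ℝ] ℝ :=
  LinearMap.mkContinuous₂ (LinearMap.mk₂ ℝ (fun v w : Lp ℝ 2 μ => ∫ x, θ x * (v x * w x) ∂μ)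
    (fun v v' w => by
      rw [← integral_add (integrable_density_mul hθ hk v w) (integrable_density_mul hθ hk v' w)]
      refine integral_congr_ae ?_
      filter_upwards [Lp.coeFn_add v v'] with x hx
      rw [hx, Pi.add_apply]
      ring)
    (fun a v w => by
      rw [smul_eq_mul, ← integral_const_mul]
      refine integral_congr_ae ?_
      filter_upwards [Lp.coeFn_smul a v] with x hx
      rw [hx, Pi.smul_apply, smul_eq_mul]
      ring)
    (fun v w w' => by
      rw [← integral_add (integrable_density_mul hθ hk v w) (integrable_density_mul hθ hk v w')]
      refine integral_congr_ae ?_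
      filter_upwards [Lp.coeFn_add w w'] with x hx
      rw [hx, Pi.add_apply]
      ring)
    (fun a v w => by
      rw [smul_eq_mul, ← integral_const_mul]
      refine integral_congr_ae ?_
      filter_upwards [Lp.coeFn_smul a w] with x hx
      rw [hx, Pi.smul_apply, smul_eq_mul]
      ring)) k (abs_integral_density_mul_le hθ hk)

lemma densityForm_apply {θ : X → ℝ} {k : ℝ} (hθ : Measurable θ) (hk : ∀ x, |θ x| ≤ k)
    (v w : Lp ℝ 2 μ) : densityForm μ θ k hθ hk v w = ∫ x, θ x * (v x * w x) ∂μ := rfl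

lemma integral_sq_eq_norm_sq (v : Lp ℝ 2 μ) : ∫ x, v x * v x ∂μ = ‖v‖ ^ 2 := by
  rw [← real_inner_self_eq_norm_sq, L2.inner_def]
  simp [pow_two]

lemma lintegral_enorm_sq_sub (v w : Lp ℝ 2 μ) : ∫⁻ x, ‖v x - w x‖ₑ ^ 2 ∂μ = ‖v - w‖ₑ ^ 2 := by
  have h1 := eLpNorm_nnreal_pow_eq_lintegral (μ := μ) (f := ⇑(v - w)) (p := 2) (by norm_num)
  simp only [NNReal.coe_ofNat, ENNReal.rpow_two, ENNReal.coe_ofNat] at h1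
  rw [Lp.enorm_def, h1]
  refine lintegral_congr_ae ?_
  filter_upwards [Lp.coeFn_sub v w] with x hx
  rw [hx, Pi.sub_apply]

end Form

section Weighted

variable {X : Type*} [MeasurableSpace X] {m : Measure X}

lemma weighted_eq_withDensity {f g : X → ℝ} (hf : Measurable f) (hg : Measurable g) :
    weighted m g = (weighted m f).withDensity fun x => ENNReal.ofReal (Real.exp (f x - g x)) := by
  unfold weighted
  rw [← withDensity_mul m (by fun_prop) (by fun_prop)]
  congr 1
  funext x
  rw [Pi.mul_apply, ← ENNReal.ofReal_mul (Real.exp_pos _).le, ← Real.exp_add]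
  congr 2
  ring

lemma weighted_le_smul {f g : X → ℝ} (hf : Measurable f) {δ : ℝ}
    (h : ∀ x, |g x - f x| ≤ δ) :
    weighted m g ≤ ENNReal.ofReal (Real.exp δ) • weighted m f := by
  unfold weighted
  rw [← withDensity_smul _ (by fun_prop)]
  refine withDensity_mono (Eventually.of_forall fun x => ?_)
  simp only [Pi.smul_apply, smul_eq_mul]
  rw [← ENNReal.ofReal_mul (Real.exp_pos _).le, ← Real.exp_add]
  refine ENNReal.ofReal_le_ofReal (Real.exp_le_exp.2 ?_)
  linarith [(abs_le.1 (h x)).1]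

lemma abs_exp_sub_exp_le {x y b : ℝ} (hx : x ≤ b) (hy : y ≤ b) :
    |Real.exp x - Real.exp y| ≤ Real.exp b * |x - y| := by
  have key : ∀ {x y : ℝ}, x ≤ b → y ≤ x → Real.exp x - Real.exp y ≤ Real.exp b * (x - y) := by
    intro x y hx hyx
    have h1 := Real.add_one_le_exp (y - x)
    have h2 : Real.exp y = Real.exp x * Real.exp (y - x) := by rw [← Real.exp_add]; ring_nf
    have h3 : Real.exp x ≤ Real.exp b := Real.exp_le_exp.2 hx
    have h4 := Real.exp_pos x
    calc Real.exp x - Real.exp y ≤ Real.exp x * (x - y) := by rw [h2]; nlinarith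
      _ ≤ _ := by
        have := sub_nonneg.2 hyx
        gcongr
  rcases le_total y x with h | h
  · rw [abs_of_nonneg (sub_nonneg.2 (Real.exp_le_exp.2 h)), abs_of_nonneg (sub_nonneg.2 h)]
    exact key hx h
  · rw [abs_sub_comm, abs_sub_comm x, abs_of_nonneg (sub_nonneg.2 (Real.exp_le_exp.2 h)),
      abs_of_nonneg (sub_nonneg.2 h)]
    exact key hy h

end Weighted

lemma dist_le_of_log {X : Type*} {ρ ρ' : MetricSpace X} {δ : ℝ}
    (h : ∀ x y, x ≠ y → |Real.log (ρ'.dist x y / ρ.dist x y)| ≤ δ) (x y : X) :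
    ρ.dist x y ≤ Real.exp δ * ρ'.dist x y := by
  rcases eq_or_ne x y with rfl | hxy
  · have h1 : ρ.dist x x = 0 := @dist_self X ρ.toPseudoMetricSpace x
    have h2 : ρ'.dist x x = 0 := @dist_self X ρ'.toPseudoMetricSpace x
    rw [h1, h2, mul_zero]
  · have h1 : 0 < ρ.dist x y := (@dist_pos X ρ x y).2 hxy
    have h2 : 0 < ρ'.dist x y := (@dist_pos X ρ' x y).2 hxy
    have h3 := (abs_le.1 (h x y hxy)).1
    have h4 : Real.exp (-δ) ≤ ρ'.dist x y / ρ.dist x y :=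
      (Real.le_log_iff_exp_le (div_pos h2 h1)).1 h3
    rw [le_div_iff₀ h1, Real.exp_neg, inv_mul_le_iff₀ (Real.exp_pos _)] at h4
    exact h4

/-- The subdifferential of Cheeger's energy in terms of a form representing `∫ v w dμ`. -/
lemma neg_mem_subdifferential_iff {X : Type*} [MeasurableSpace X] {μ₀ μ : Measure X}
    {ρ : MetricSpace X} (hμ : μ ≪ μ₀) {b : Lp ℝ 2 μ₀ →L[ℝ] Lp ℝ 2 μ₀ →L[ℝ] ℝ}
    (hb : ∀ v w, b v w = ∫ x, v x * w x ∂μ) (u p : Lp ℝ 2 μ₀) :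
    -p ∈ subdifferential ρ μ u ↔
      IsDescentDirection (fun v : Lp ℝ 2 μ₀ => cheeger ρ μ v) b u p := by
  have hint : ∀ w : Lp ℝ 2 μ₀, ∫ x, (-p : Lp ℝ 2 μ₀) x * (w x - u x) ∂μ = b p (u - w) := by
    intro w
    have h1 : b p (u - w) = b (-p) (w - u) := by simp
    rw [h1, hb]
    refine integral_congr_ae ?_
    filter_upwards [hμ.ae_le (Lp.coeFn_sub w u)] with x hx
    rw [hx, Pi.sub_apply]
  simp only [subdifferential, mem_ofPred_eq, IsDescentDirection, hint, lt_top_iff_ne_top]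
  refine and_congr_right fun hu => forall_congr' fun w => ?_
  by_cases hw : cheeger ρ μ w = ⊤
  · simp [hw]
  · rw [← EReal.coe_ennreal_toReal hu, ← EReal.coe_ennreal_toReal hw, ← EReal.coe_add,
      EReal.coe_le_coe_iff]
    constructor
    · intro h _
      linarith
    · intro h
      linarith [h hw]

/-- Cheeger's energies of a log-Lipschitz family of metric measure spaces, on a fixed `L²`-space. -/
theorem exists_evolvingEnergy_cheeger {X : Type*} [τ : TopologicalSpace X] [MeasurableSpace X]
    [BorelSpace X] {d : ℝ → MetricSpace X}
    (d_top : ∀ t, (d t).toUniformSpace.toTopologicalSpace = τ)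
    {L : ℝ} (hL : 0 ≤ L)
    (d_log : ∀ s t, ∀ x y : X, x ≠ y → |Real.log ((d t).dist x y / (d s).dist x y)| ≤ L * |t - s|)
    {m : Measure X} {f : ℝ → X → ℝ} (f_meas : ∀ t, Measurable (f t)) {L' : ℝ} (hL' : 0 ≤ L')
    (f_lip : ∀ s t x, |f t x - f s x| ≤ L' * |t - s|) {g : X → ℝ} (hg : Measurable g) {b : ℝ}
    (hgb : ∀ t x, |f t x - g x| ≤ b) :
    ∃ (B : ℝ → Lp ℝ 2 (weighted m g) →L[ℝ] Lp ℝ 2 (weighted m g) →L[ℝ] ℝ) (C c K : ℝ),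
      (∀ t v w, B t v w = ∫ x, v x * w x ∂(weighted m (f t))) ∧
      EvolvingEnergy (fun t (v : Lp ℝ 2 (weighted m g)) => cheeger (d t) (weighted m (f t)) v)
        B C c K := by
  set μ := weighted m g with hμ
  let θ : ℝ → X → ℝ := fun t x => Real.exp (g x - f t x)
  have hθ : ∀ t, Measurable (θ t) := fun t => by
    have := f_meas t
    fun_prop
  have hle : ∀ t x, g x - f t x ≤ b := fun t x => by linarith [(abs_le.1 (hgb t x)).1]
  have hge : ∀ t x, -b ≤ g x - f t x := fun t x => by linarith [(abs_le.1 (hgb t x)).2]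
  have hθk : ∀ t x, |θ t x| ≤ Real.exp b := fun t x => by
    rw [abs_of_pos (Real.exp_pos _)]
    exact Real.exp_le_exp.2 (hle t x)
  have hac : ∀ t, weighted m (f t) ≪ μ := fun t => by
    rw [weighted_eq_withDensity hg (f_meas t)]
    exact withDensity_absolutelyContinuous _ _
  let B : ℝ → Lp ℝ 2 μ →L[ℝ] Lp ℝ 2 μ →L[ℝ] ℝ := fun t =>
    densityForm μ (θ t) (Real.exp b) (hθ t) (hθk t)
  -- In the energy `L` counts twice because the slope is squared, and `L'` comes from the measure.
  -- The density `θ t` lies in `[e^{-b}, e^b]` and is `e^b L'`-Lipschitz in `t`; the last constant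
  -- covers both size and Lipschitz bounds.
  refine ⟨B, 2 * L + L', Real.exp (-b), Real.exp b * (1 + L'), fun t v w => ?_, ?_⟩
  · rw [weighted_eq_withDensity hg (f_meas t), integral_withDensity_eq_integral_toReal_smul
      (hθ t).ennreal_ofReal (Eventually.of_forall fun x => ENNReal.ofReal_lt_top)]
    simp only [B, densityForm_apply, smul_eq_mul, ENNReal.toReal_ofReal (Real.exp_pos _).le, θ]
    rfl
  refine ⟨by positivity, Real.exp_pos _, by positivity, ?_, ?_, ?_, ?_, ?_, ?_, ?_⟩
  · intro t u v a c ha hc hac'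
    have h1 : ⇑(a • u + c • v) =ᵐ[weighted m (f t)] fun x => a * u x + c * v x := by
      filter_upwards [(hac t).ae_le (Lp.coeFn_add (a • u) (c • v)),
        (hac t).ae_le (Lp.coeFn_smul a u), (hac t).ae_le (Lp.coeFn_smul c v)] with x h1 h2 h3
      rw [h1, Pi.add_apply, h2, h3]
      rfl
    rw [cheeger_congr_ae (d t) h1]
    exact cheeger_convex (d_top t)
      ((Lp.aestronglyMeasurable u).aemeasurable.mono_ac (hac t)) ha hc hac'
  · intro t
    rw [lowerSemicontinuous_iff_isClosed_preimage]
    intro c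
    refine IsSeqClosed.isClosed fun v u hv hlim => ?_
    refine cheeger_le_of_tendsto (d_top t)
      (fun n => (Lp.aestronglyMeasurable (v n)).aemeasurable.mono_ac (hac t)) ?_ hv
    have hz : Tendsto (fun n => ENNReal.ofReal (Real.exp b) * ‖v n - u‖ₑ ^ 2) atTop (𝓝 0) := by
      have h1 : Tendsto (fun n => ‖v n - u‖ₑ) atTop (𝓝 0) := by
        have := (hlim.sub_const u).enorm
        simpa using this
      have h2 := ENNReal.Tendsto.const_mul (ENNReal.Tendsto.pow (n := 2) h1)
        (Or.inr (@ENNReal.ofReal_ne_top (Real.exp b)))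
      simpa using h2
    refine tendsto_of_tendsto_of_tendsto_of_le_of_le tendsto_const_nhds hz (fun _ => zero_le)
      fun n => ?_
    refine (lintegral_mono' (weighted_le_smul hg (hgb t)) le_rfl).trans (le_of_eq ?_)
    rw [lintegral_smul_measure, smul_eq_mul, lintegral_enorm_sq_sub]
  · intro s t u
    have h1 := cheeger_le_of_dist_le (ρ := d s) (ρ' := d t) ((d_top s).trans (d_top t).symm)
      (Real.exp_pos _) (dist_le_of_log (d_log s t)) (Real.exp_pos _)
      (weighted_le_smul (m := m) (f_meas s) (f_lip s t)) u
    refine h1.trans (le_of_eq ?_)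
    congr 2
    rw [← Real.exp_nat_mul, ← Real.exp_add]
    congr 1
    push_cast
    ring
  · intro t u v
    simp only [B, densityForm_apply]
    congr 1
    funext x
    ring
  · intro t u
    simp only [B, densityForm_apply]
    rw [← integral_sq_eq_norm_sq, ← integral_const_mul]
    refine integral_mono (((Lp.memLp u).integrable_mul (Lp.memLp u)).const_mul _)
      (integrable_density_mul (hθ t) (hθk t) u u) fun x => ?_
    refine mul_le_mul_of_nonneg_right (Real.exp_le_exp.2 (hge t x)) (mul_self_nonneg _)
  · intro t u v
    refine (abs_integral_density_mul_le (hθ t) (hθk t) u v).trans ?_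
    gcongr
    exact le_mul_of_one_le_right (Real.exp_pos _).le (by linarith)
  · intro s t u v
    simp only [B, densityForm_apply]
    rw [← integral_sub (integrable_density_mul (hθ t) (hθk t) u v)
      (integrable_density_mul (hθ s) (hθk s) u v)]
    simp only [← sub_mul]
    refine abs_integral_density_mul_le ((hθ t).sub (hθ s)) (fun x => ?_) u v
    refine (abs_exp_sub_exp_le (hle t x) (hle s x)).trans ?_
    rw [mul_assoc]
    gcongr
    rw [sub_sub_sub_cancel_left, abs_sub_comm]
    refine (f_lip s t x).trans ?_
    gcongr
    linarith

end DynamicCheeger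

/-! ### The theorem for Cheeger's energies on `[0, T]`. -/

theorem mainTheorem5 {X : Type*} [TopologicalSpace X] [PolishSpace X]
    [MeasurableSpace X] [BorelSpace X]
    (T : ℝ) (hT : 0 < T)
    -- the metrics: complete, inducing the topology of `X`, log-Lipschitz in time
    (d : ℝ → MetricSpace X)
    (d_top : ∀ t ∈ Icc 0 T, (d t).toUniformSpace.toTopologicalSpace = ‹TopologicalSpace X›)
    (d_complete : ∀ t ∈ Icc 0 T, @CompleteSpace X (d t).toUniformSpace)
    (L : ℝ)
    (d_log : ∀ s ∈ Icc 0 T, ∀ t ∈ Icc 0 T, ∀ x y : X, x ≠ y →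
      |Real.log ((d t).dist x y / (d s).dist x y)| ≤ L * |t - s|)
    -- the measures `e^{-f t} m`
    (m : Measure X) [SigmaFinite m]
    (f : ℝ → X → ℝ) (f_meas : ∀ t ∈ Icc 0 T, Measurable (f t))
    (L' : ℝ) (f_lip : ∀ s ∈ Icc 0 T, ∀ t ∈ Icc 0 T, ∀ x : X, |f t x - f s x| ≤ L' * |t - s|)
    -- the space `L²(X, e^{-f r} m)`, which as a set does not depend on the time `r`
    (r : ℝ) (hr : r ∈ Icc 0 T)
    (u₀ : Lp ℝ 2 (DynamicCheeger.weighted m (f r)))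
    (hu₀ : DynamicCheeger.cheeger (d 0) (DynamicCheeger.weighted m (f 0)) u₀ < ⊤) :
    ∃ u : ℝ → Lp ℝ 2 (DynamicCheeger.weighted m (f r)),
      DynamicCheeger.IsGradientFlow d (fun t => DynamicCheeger.weighted m (f t)) T u₀ u ∧
      (∀ t ∈ Icc 0 T, DynamicCheeger.cheeger (d t) (DynamicCheeger.weighted m (f t)) (u t) < ⊤) ∧
      ∀ v : ℝ → Lp ℝ 2 (DynamicCheeger.weighted m (f r)),
        DynamicCheeger.IsGradientFlow d (fun t => DynamicCheeger.weighted m (f t)) T u₀ v →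
          EqOn v u (Icc 0 T) := by
  -- The projection of times onto `[0, T]` is 1-Lipschitz, so it extends all data to every real time
  -- with constants `|L|` and `|L'|`.
  let π : ℝ → ℝ := fun t => projIcc 0 T hT.le t
  have hπ : ∀ t, π t ∈ Icc 0 T := fun t => (projIcc 0 T hT.le t).2
  have hπ_of_mem : ∀ t ∈ Icc 0 T, π t = t := fun t ht => by
    simp only [π, projIcc_of_mem hT.le ht]
  have hπ_lip : ∀ s t, |π t - π s| ≤ |t - s| := fun s t => by
    have := (LipschitzWith.projIcc hT.le).dist_le_mul t s
    simpa [π, Subtype.dist_eq, Real.dist_eq] using this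
  have hmul : ∀ (l s t : ℝ), l * |π t - π s| ≤ |l| * |t - s| := fun l s t =>
    mul_le_mul (le_abs_self l) (hπ_lip s t) (abs_nonneg _) (abs_nonneg _)
  obtain ⟨B, C, c, K, hB, S⟩ := DynamicCheeger.exists_evolvingEnergy_cheeger
    (d := fun t => d (π t)) (fun t => d_top _ (hπ t)) (abs_nonneg L)
    (fun s t x y hxy => (d_log _ (hπ s) _ (hπ t) x y hxy).trans (hmul L s t))
    (m := m) (f := fun t => f (π t)) (fun t => f_meas _ (hπ t)) (abs_nonneg L')
    (fun s t x => (f_lip _ (hπ s) _ (hπ t) x).trans (hmul L' s t)) (f_meas r hr)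
    (b := |L'| * T) (fun t x => (f_lip r hr _ (hπ t) x).trans (by
      refine mul_le_mul (le_abs_self _) ?_ (abs_nonneg _) (abs_nonneg _)
      rw [abs_le]
      constructor <;> linarith [(hπ t).1, (hπ t).2, hr.1, hr.2]))
  have h0T : (0 : ℝ) ∈ Icc 0 T := left_mem_Icc.2 hT.le
  have hiff : ∀ t ∈ Icc 0 T, ∀ v p : Lp ℝ 2 (DynamicCheeger.weighted m (f r)),
      -p ∈ DynamicCheeger.subdifferential (d t) (DynamicCheeger.weighted m (f t)) v ↔
      DynamicCheeger.IsDescentDirection (fun w : Lp ℝ 2 (DynamicCheeger.weighted m (f r)) =>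
        DynamicCheeger.cheeger (d (π t)) (DynamicCheeger.weighted m (f (π t))) w) (B t) v p := by
    intro t ht v p
    rw [← DynamicCheeger.neg_mem_subdifferential_iff ?_ (hB t), hπ_of_mem t ht]
    rw [DynamicCheeger.weighted_eq_withDensity (f_meas r hr) (f_meas _ (hπ t))]
    exact withDensity_absolutelyContinuous _ _
  -- `exists_flow` gives finite energy only before the final time; running up to `T + 1` includes `t
  -- = T`.
  obtain ⟨u, hac, hu0, hder, hfin⟩ := S.exists_flow (u₀ := u₀)
    (by simpa only [hπ_of_mem 0 h0T] using hu₀.ne) (T := T + 1) (by linarith)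
  have hac' : AbsolutelyContinuousOnInterval u 0 T := hac.mono (by
    rw [uIcc_of_le hT.le, uIcc_of_le (by linarith)]
    exact Icc_subset_Icc_right (by linarith))
  have hder' := hder.mono fun t h (ht : t ∈ Ioo 0 T) => h ⟨ht.1, ht.2.trans (by linarith)⟩
  have hzero : ∀ v : ℝ → Lp ℝ 2 (DynamicCheeger.weighted m (f r)),
      AbsolutelyContinuousOnInterval v 0 T → Tendsto v (𝓝[>] 0) (𝓝 (v 0)) := fun v hv => by
    have h1 := hv.continuousOn 0 left_mem_uIcc
    rw [uIcc_of_le hT.le] at h1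
    have h2 := h1.mono Ioc_subset_Icc_self
    rwa [ContinuousWithinAt, nhdsWithin_Ioc_eq_nhdsGT hT] at h2
  refine ⟨u, ⟨hac', ?_, hu0 ▸ hzero u hac'⟩, ?_, ?_⟩
  · filter_upwards [hder'] with t h ht
    obtain ⟨u', hd, hsub⟩ := h ht
    exact ⟨u', hd, (hiff t (Ioo_subset_Icc_self ht) _ _).2 hsub⟩
  · intro t ht
    have := hfin t ⟨ht.1, by linarith [ht.2]⟩
    simp only [hπ_of_mem t ht] at this
    exact this.lt_top
  · intro v hv
    -- A gradient flow prescribes only the right limit at `0`; continuity turns it into the value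
    -- there.
    have hv0 : v 0 = u₀ := tendsto_nhds_unique (hzero v hv.absolutelyContinuous) hv.initial
    refine S.flow_unique hT hv.absolutelyContinuous hac' (hv0.trans hu0.symm) ?_ hder'
    filter_upwards [hv.deriv_mem] with t h ht
    obtain ⟨v', hd, hsub⟩ := h ht
    exact ⟨v', hd, (hiff t (Ioo_subset_Icc_self ht) _ _).1 hsub⟩
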